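/- **Setting.** A *category with dependence* (CwD) is a category $\mathcal C$ with a class $\mathscr D(\Gamma)$ of D-objects over each object $\Gamma$, a class $\mathscr D(\Gamma,A)$ of D-morphisms $\Gamma\rightharpoonup A$ for each $A\in\mathscr D(\Gamma)$, and D-compositions $A\mapsto A\{\phi\}$, $a\mapsto a\{\phi\}$ along morphisms $\phi:\Delta\to\Gamma$, strictly functorial in $\phi$. A *strict cartesian closed CwD* (strict CCCwD) is a CwD equipped with: * a terminal object $T$ and, for all $\Gamma$ and $A\in\mathscr D(\Gamma)$, a semi-$\Sigma$-space: an object $\Gamma.A$ with $\pi_1:\Gamma.A\to\Gamma$ and $\pi_2:\Gamma.A\rightharpoonup A\{\pi_1\}$ such that for all $\phi:\Delta\to\Gamma$, $g:\Delta\rightharpoonup A\{\phi\}$ there is a unique $\langle\phi,g\rangle:\Delta\to\Gamma.A$ with $\pi_1\circ\langle\phi,g\rangle=\phi$ and $\pi_2\{\langle\phi,g\rangle\}=g$. Write $\overline{a}=\langle \mathit{id}_\Gamma,a\rangle:\Gamma\to\Gamma.A$ for $a:\Gamma\rightharpoonup A$, and $\phi^+=\langle\phi\circ\pi_1,\pi_2\rangle:\Delta.A\{\phi\}\to\Gamma.A$;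 * a unit D-object $1\in\mathscr D(T)$: for each $\Gamma$ there is exactly one D-morphism $\Gamma\rightharpoonup 1\{!_\Gamma\}$; * for all $A\in\mathscr D(\Gamma)$, $B\in\mathscr D(\Gamma.A)$ a $\Sigma$-space: $\Sigma(A,B)\in\mathscr D(\Gamma)$ with $\varpi_1:\Gamma.\Sigma(A,B)\rightharpoonup A\{\pi_1\}$ and $\varpi_2:\Gamma.\Sigma(A,B)\rightharpoonup B\{\langle\pi_1,\varpi_1\rangle\}$ such that for all $\phi:\Delta\to\Gamma$, $g:\Delta\rightharpoonup A\{\phi\}$, $h:\Delta\rightharpoonup B\{\langle\phi,g\rangle\}$ there is a unique $(\!( g,h)\!):\Delta\rightharpoonup\Sigma(A,B)\{\phi\}$ with $\varpi_1\{\langle\phi,(\!( g,h)\!)\rangle\}=g$, $\varpi_2\{\langle\phi,(\!( g,h)\!)\rangle\}=h$; the family is coherent: $\Sigma(A,B)\{\phi\}=\Sigma(A\{\phi\},B\{\phi^+\})$, and reindexing along $\phi$ takes the projections $\varpi_i$ of $\Sigma(A,B)$ to those of $\Sigma(A\{\phi\},B\{\phi^+\})$; * for all such $A,B$ a $\Pi$-space: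 $\Pi(A,B)\in\mathscr D(\Gamma)$ with $\mathit{dev}:\Gamma.\Pi(A,B).A\{\pi_1\}\rightharpoonup B\{\pi_1^+\}$ such that (i) it is a pseudo-$\Pi$-space: for every $f:\Gamma.A\rightharpoonup B$ there is a unique $\Lambda(f):\Gamma\rightharpoonup\Pi(A,B)$ with $\mathit{dev}\{\langle\overline{\Lambda(f)}\circ\pi_1,\pi_2\rangle\}=f$; and (ii) for every $Z\in\mathscr D(\Gamma)$ its weakening along $\pi_1:\Gamma.Z\to\Gamma$ is a pseudo-$\Pi$-space, whose currying $\Lambda_Z$ satisfies $\mathit{dev}\{\langle\langle\pi_1,\Lambda_Z(h)\rangle\circ\pi_1,\pi_2\rangle\}=h$ and $\Lambda_Y(h\{\langle\langle\pi_1,g\rangle\circ\pi_1,\pi_2\rangle\})=\Lambda_Z(h)\{\langle\pi_1,g\rangle\}$ for all $h:\Gamma.Z.A\{\pi_1\}\rightharpoonup B\{\pi_1^+\}$, $Y\in\mathscr D(\Gamma)$ and $g:\Gamma.Y\rightharpoonup Z\{\pi_1\}$; the family is coherent: $\Pi(A,B)\{\phi\}=\Pi(A\{\phi\},B\{\phi^+\})$,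 and reindexing along $\phi$ takes $\mathit{dev}$ to $\mathit{dev}$. $\mathsf{MLTT}(1,\Pi,\Sigma)$ is Martin-Löf type theory with exactly the unit type, $\Pi$-types and $\Sigma$-types, each with its formation, introduction, elimination, computation and uniqueness rules, together with the structural, weakening, substitution and congruence rules. **Statement.** Let $\mathcal C$ be a strict CCCwD. With $\mathit{Ty}=\mathscr D(\_)$, $\mathit{Tm}=\mathscr D(\_,\_)$, D-composition as substitution, terminal object $T$, comprehension $\Gamma.A$, projections $p=\pi_1$, $v=\pi_2$ and extension $\langle\_,\_\rangle$, it is a category with families (CwF), and this CwF supports $1$-, $\Sigma$- and $\Pi$-types in the strict sense: it has operations * $1_\Gamma$, $\star_\Gamma$, stable under substitution, where $\star_\Gamma$ is the only term of type $1_\Gamma$; * $\Sigma(A,B)$, $\mathit{Pair}_{A,B}:\Gamma.A.B\to\Gamma.\Sigma(A,B)$ over $\Gamma$, and, for every type $P$ over $\Gamma.\Sigma(A,B)$ and every term $f$ of type $P\{\mathit{Pair}_{A,B}\}$ over $\Gamma.A.B$, a term $\mathcal R_P(f)$ of type $P$ over $\Gamma.\Sigma(A,B)$, all stable under substitution, where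 $\mathcal R_P(f)$ is the only term $g$ of type $P$ with $g\{\mathit{Pair}_{A,B}\}=f$; * $\Pi(A,B)$, $\lambda(f)$, $\mathit{App}(h,a)$, stable under substitution, with $\mathit{App}(\lambda(f),a)=f\{\overline a\}$ and $\lambda(\mathit{App}(h\{p\},v))=h$ for every term $h$ of type $\Pi(A,B)$ over $\Gamma$. These operations are the ones given by $\mathcal C$: $1_\Gamma=1\{!_\Gamma\}$, $\Sigma(A,B)$ and $\Pi(A,B)$ are the specified spaces, $\mathit{Pair}_{A,B}=\langle\pi_1\circ\pi_1,(\!(\pi_2\{\pi_1\},\pi_2)\!)\rangle$, and $\lambda=\Lambda$. If moreover $\pi_2^{\Gamma.A}\{\pi_1^{\Gamma.A.A\{\pi_1\}}\}=\pi_2^{\Gamma.A.A\{\pi_1\}}$ for all $\Gamma$ and $A$, then also $\lambda(\mathit{App}(k,v))\{p\}=k$ for every term $k$ of type $\Pi(A,B)\{p\}$ over $\Gamma.A$. Consequently the interpretation $[\![\_]\!]$ of $\mathsf{MLTT}(1,\Pi,\Sigma)$ in this CwF, defined by the usual clauses on contexts, types and terms, is sound: every derivable context, type in context and term in context has exactly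 one interpretation, and if $\vdash\Gamma=\Gamma'\ \mathrm{ctx}$ (respectively $\Gamma\vdash A=A'\ \mathrm{type}$, $\Gamma\vdash a=a':A$) is derivable, then $[\![\Gamma]\!]=[\![\Gamma']\!]$ (respectively $[\![ A]\!]=[\![ A']\!]$, $[\![ a]\!]=[\![ a']\!]$). -/

import Mathlib

open CategoryTheory CategoryTheory.Limits

namespace DepCat

universe w₂ w₁ v u

/-! ## Categories with dependence -/

/-- A category with dependence on `C`: dependent objects `Ty Γ` over each object `Γ`, dependent
morphisms `Tm Γ A` from `Γ` to a dependent object `A` over `Γ`, and dependent compositions with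
morphisms, which are strictly functorial. Equations between dependent morphisms whose codomains
are only provably equal are written with `HEq`. -/
structure CwD (C : Type u) [Category.{v} C] where
  Ty : C → Type w₁
  Tm : (Γ : C) → Ty Γ → Type w₂
  tySub : {Δ Γ : C} → (Δ ⟶ Γ) → Ty Γ → Ty Δ
  tmSub : {Δ Γ : C} → (φ : Δ ⟶ Γ) → {A : Ty Γ} → Tm Γ A → Tm Δ (tySub φ A)
  tySub_id : ∀ {Γ : C} (A : Ty Γ), tySub (𝟙 Γ) A = A
  tySub_comp : ∀ {Θ Δ Γ : C} (ψ : Θ ⟶ Δ) (φ : Δ ⟶ Γ) (A : Ty Γ),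
    tySub (ψ ≫ φ) A = tySub ψ (tySub φ A)
  tmSub_id : ∀ {Γ : C} {A : Ty Γ} (a : Tm Γ A), HEq (tmSub (𝟙 Γ) a) a
  tmSub_comp : ∀ {Θ Δ Γ : C} (ψ : Θ ⟶ Δ) (φ : Δ ⟶ Γ) {A : Ty Γ} (a : Tm Γ A),
    HEq (tmSub (ψ ≫ φ) a) (tmSub ψ (tmSub φ a))

variable {C : Type u} [Category.{v} C]

namespace CwD

variable (D : CwD.{w₂, w₁} C)

/-- Transport of a dependent morphism along an equality of its codomain. -/
def cast {Γ : C} {A B : D.Ty Γ} (h : A = B) (a : D.Tm Γ A) : D.Tm Γ B := h ▸ a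

theorem cast_heq {Γ : C} {A B : D.Ty Γ} (h : A = B) (a : D.Tm Γ A) : HEq (D.cast h a) a := by
  subst h; rfl

theorem tmSub_congr {Δ Γ : C} {φ ψ : Δ ⟶ Γ} {A B : D.Ty Γ} {a : D.Tm Γ A} {b : D.Tm Γ B}
    (h : φ = ψ) (hA : A = B) (hab : HEq a b) : HEq (D.tmSub φ a) (D.tmSub ψ b) := by
  subst h; subst hA; cases hab; rfl

end CwD

/-- The data of a specified object `T`, together with a specified object `Γ.A`, a first
projection and a second projection for every `Γ` and every dependent object `A` over `Γ`;
`T` is terminal. -/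
structure Comprehension (D : CwD.{w₂, w₁} C) where
  T : C
  isTerminal : IsTerminal T
  ext : (Γ : C) → D.Ty Γ → C
  p : {Γ : C} → (A : D.Ty Γ) → (ext Γ A ⟶ Γ)
  q : {Γ : C} → (A : D.Ty Γ) → D.Tm (ext Γ A) (D.tySub (p A) A)

/-- The specified objects `Γ.A` with their projections are semi-dependent pair spaces: for
`φ : Δ ⟶ Γ` and a dependent morphism `g` from `Δ` to `A{φ}` there is a unique morphism
`pair φ A g : Δ ⟶ Γ.A` with the two projections `φ` and `g`. -/
structure SemiCartesian {D : CwD.{w₂, w₁} C} (K : Comprehension D) where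
  pair : {Δ Γ : C} → (φ : Δ ⟶ Γ) → (A : D.Ty Γ) → D.Tm Δ (D.tySub φ A) → (Δ ⟶ K.ext Γ A)
  pair_p : ∀ {Δ Γ : C} (φ : Δ ⟶ Γ) (A : D.Ty Γ) (g : D.Tm Δ (D.tySub φ A)),
    pair φ A g ≫ K.p A = φ
  pair_q : ∀ {Δ Γ : C} (φ : Δ ⟶ Γ) (A : D.Ty Γ) (g : D.Tm Δ (D.tySub φ A)),
    HEq (D.tmSub (pair φ A g) (K.q A)) g
  pair_unique : ∀ {Δ Γ : C} (φ : Δ ⟶ Γ) (A : D.Ty Γ) (g : D.Tm Δ (D.tySub φ A))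
    (m : Δ ⟶ K.ext Γ A), m ≫ K.p A = φ → HEq (D.tmSub m (K.q A)) g → m = pair φ A g

/-! ## Categories with families -/

/-- A category with families whose types, terms, substitutions, terminal object, comprehensions
and projections are those of `D` and `K`. -/
structure CwF {D : CwD.{w₂, w₁} C} (K : Comprehension D) where
  pair : {Δ Γ : C} → (φ : Δ ⟶ Γ) → (A : D.Ty Γ) → D.Tm Δ (D.tySub φ A) → (Δ ⟶ K.ext Γ A)
  cons_l : ∀ {Δ Γ : C} (φ : Δ ⟶ Γ) (A : D.Ty Γ) (g : D.Tm Δ (D.tySub φ A)),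
    pair φ A g ≫ K.p A = φ
  cons_r : ∀ {Δ Γ : C} (φ : Δ ⟶ Γ) (A : D.Ty Γ) (g : D.Tm Δ (D.tySub φ A)),
    HEq (D.tmSub (pair φ A g) (K.q A)) g
  cons_nat : ∀ {Θ Δ Γ : C} (ψ : Θ ⟶ Δ) (φ : Δ ⟶ Γ) (A : D.Ty Γ) (g : D.Tm Δ (D.tySub φ A)),
    ψ ≫ pair φ A g = pair (ψ ≫ φ) A (D.cast (D.tySub_comp ψ φ A).symm (D.tmSub ψ g))
  cons_id : ∀ {Γ : C} (A : D.Ty Γ), pair (K.p A) A (K.q A) = 𝟙 (K.ext Γ A)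

/-- Semi-dependent pairings are the extensions of a category with families. -/
def SemiCartesian.toCwF {D : CwD.{w₂, w₁} C} {K : Comprehension D} (S : SemiCartesian K) :
    CwF K where
  pair := S.pair
  cons_l := S.pair_p
  cons_r := S.pair_q
  cons_nat ψ φ A g := by
    apply S.pair_unique
    · rw [Category.assoc, S.pair_p]
    · refine (D.tmSub_comp _ _ _).trans (HEq.trans ?_ (D.cast_heq _ _).symm)
      refine D.tmSub_congr rfl ?_ (S.pair_q φ A g)
      rw [← D.tySub_comp, S.pair_p]
  cons_id A := by
    symm
    apply S.pair_unique
    · exact Category.id_comp _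
    · exact D.tmSub_id _

namespace CwF

variable {D : CwD.{w₂, w₁} C} {K : Comprehension D} (F : CwF K)

theorem pair_congr {Δ Γ : C} {φ ψ : Δ ⟶ Γ} {A : D.Ty Γ} {g : D.Tm Δ (D.tySub φ A)}
    {h : D.Tm Δ (D.tySub ψ A)} (e : φ = ψ) (e' : HEq g h) : F.pair φ A g = F.pair ψ A h := by
  subst e; cases e'; rfl

/-- The morphism `⟨φ ∘ p, v⟩ : Δ.A' ⟶ Γ.A` for `φ : Δ ⟶ Γ`, where `A' = A{φ}`. -/
def liftOf {Δ Γ : C} (φ : Δ ⟶ Γ) (A : D.Ty Γ) (A' : D.Ty Δ) (h : A' = D.tySub φ A) :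
    K.ext Δ A' ⟶ K.ext Γ A :=
  F.pair (K.p A' ≫ φ) A (D.cast (by rw [h, D.tySub_comp]) (K.q A'))

/-- The morphism `φ⁺ = ⟨φ ∘ p, v⟩ : Δ.A{φ} ⟶ Γ.A` for `φ : Δ ⟶ Γ`. -/
def lift {Δ Γ : C} (φ : Δ ⟶ Γ) (A : D.Ty Γ) : K.ext Δ (D.tySub φ A) ⟶ K.ext Γ A :=
  F.liftOf φ A (D.tySub φ A) rfl

/-- The section `⟨id, a⟩ : Γ ⟶ Γ.A` given by a dependent morphism `a` from `Γ` to `A`. -/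
def sect {Γ : C} {A : D.Ty Γ} (a : D.Tm Γ A) : Γ ⟶ K.ext Γ A :=
  F.pair (𝟙 Γ) A (D.cast (D.tySub_id A).symm a)

theorem liftOf_p {Δ Γ : C} (φ : Δ ⟶ Γ) (A : D.Ty Γ) (A' : D.Ty Δ) (h : A' = D.tySub φ A) :
    F.liftOf φ A A' h ≫ K.p A = K.p A' ≫ φ := F.cons_l _ _ _

theorem liftOf_q {Δ Γ : C} (φ : Δ ⟶ Γ) (A : D.Ty Γ) (A' : D.Ty Δ) (h : A' = D.tySub φ A) :
    HEq (D.tmSub (F.liftOf φ A A' h) (K.q A)) (K.q A') :=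
  (F.cons_r _ _ _).trans (D.cast_heq _ _)

theorem lift_p {Δ Γ : C} (φ : Δ ⟶ Γ) (A : D.Ty Γ) :
    F.lift φ A ≫ K.p A = K.p (D.tySub φ A) ≫ φ := F.cons_l _ _ _

theorem sect_p {Γ : C} {A : D.Ty Γ} (a : D.Tm Γ A) : F.sect a ≫ K.p A = 𝟙 Γ := F.cons_l _ _ _

theorem sect_q {Γ : C} {A : D.Ty Γ} (a : D.Tm Γ A) : HEq (D.tmSub (F.sect a) (K.q A)) a :=
  (F.cons_r _ _ _).trans (D.cast_heq _ _)

theorem hom_ext (F : CwF K) {Δ Γ : C} {A : D.Ty Γ} {m n : Δ ⟶ K.ext Γ A} (hp : m ≫ K.p A = n ≫ K.p A)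
    (hq : HEq (D.tmSub m (K.q A)) (D.tmSub n (K.q A))) : m = n := by
  rw [← Category.comp_id m, ← Category.comp_id n, ← F.cons_id A, F.cons_nat, F.cons_nat]
  exact F.pair_congr hp (((D.cast_heq _ _).trans hq).trans (D.cast_heq _ _).symm)

theorem tmSub_comp_q {Θ Δ Γ : C} (ψ : Θ ⟶ Δ) {A : D.Ty Γ} (m : Δ ⟶ K.ext Γ A) {B : D.Ty Δ}
    {b : D.Tm Δ B} (hB : D.tySub (m ≫ K.p A) A = B) (h : HEq (D.tmSub m (K.q A)) b) :
    HEq (D.tmSub (ψ ≫ m) (K.q A)) (D.tmSub ψ b) :=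
  (D.tmSub_comp ψ m _).trans (D.tmSub_congr rfl (by rw [← hB, D.tySub_comp]) h)

/-- Every projection `p : Γ.A.B ⟶ Γ.A` is the extension of `p ∘ p` by `v{p}`. -/
theorem eq_pair_proj {Γ : C} {A : D.Ty Γ} (B : D.Ty (K.ext Γ A)) :
    K.p B = F.pair (K.p B ≫ K.p A) A
      (D.cast (D.tySub_comp _ _ _).symm (D.tmSub (K.p B) (K.q A))) := by
  rw [← F.cons_nat, F.cons_id, Category.comp_id]

/-- `p⁺ ∘ ⟨id, v⟩ = id` on `Γ.A`. -/
theorem sect_q_lift {Γ : C} (A : D.Ty Γ) :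
    F.sect (K.q A) ≫ F.lift (K.p A) A = 𝟙 (K.ext Γ A) := by
  apply F.hom_ext
  · rw [Category.assoc, F.lift_p, ← Category.assoc, F.sect_p, Category.id_comp]
  · refine (tmSub_comp_q _ _ ?_ (F.liftOf_q _ _ _ rfl)).trans
      ((F.sect_q _).trans (D.tmSub_id _).symm)
    rw [F.liftOf_p, D.tySub_comp]

/-! ### Semantic type formers -/

/-- Support of the unit type. -/
structure UnitType (F : CwF K) where
  one : (Γ : C) → D.Ty Γ
  star : (Γ : C) → D.Tm Γ (one Γ)
  one_sub : ∀ {Δ Γ : C} (φ : Δ ⟶ Γ), D.tySub φ (one Γ) = one Δ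
  star_sub : ∀ {Δ Γ : C} (φ : Δ ⟶ Γ), HEq (D.tmSub φ (star Γ)) (star Δ)

/-- Support of the unit type in the strict sense. -/
def UnitType.Strict {F : CwF K} (U : F.UnitType) : Prop :=
  ∀ {Γ : C} (f : D.Tm Γ (U.one Γ)), f = U.star Γ

/-- Support of dependent function types. -/
structure PiTypes (F : CwF K) where
  pi : {Γ : C} → (A : D.Ty Γ) → D.Ty (K.ext Γ A) → D.Ty Γ
  lam : {Γ : C} → {A : D.Ty Γ} → {B : D.Ty (K.ext Γ A)} → D.Tm (K.ext Γ A) B → D.Tm Γ (pi A B)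
  app : {Γ : C} → {A : D.Ty Γ} → {B : D.Ty (K.ext Γ A)} → D.Tm Γ (pi A B) → (a : D.Tm Γ A) →
    D.Tm Γ (D.tySub (F.sect a) B)
  app_lam : ∀ {Γ : C} {A : D.Ty Γ} {B : D.Ty (K.ext Γ A)} (f : D.Tm (K.ext Γ A) B)
    (a : D.Tm Γ A), app (lam f) a = D.tmSub (F.sect a) f
  pi_sub : ∀ {Δ Γ : C} (φ : Δ ⟶ Γ) (A : D.Ty Γ) (B : D.Ty (K.ext Γ A)),
    D.tySub φ (pi A B) = pi (D.tySub φ A) (D.tySub (F.lift φ A) B)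
  lam_sub : ∀ {Δ Γ : C} (φ : Δ ⟶ Γ) {A : D.Ty Γ} {B : D.Ty (K.ext Γ A)}
    (g : D.Tm (K.ext Γ A) B), HEq (D.tmSub φ (lam g)) (lam (D.tmSub (F.lift φ A) g))
  app_sub : ∀ {Δ Γ : C} (φ : Δ ⟶ Γ) {A : D.Ty Γ} {B : D.Ty (K.ext Γ A)} (h : D.Tm Γ (pi A B))
    (a : D.Tm Γ A), HEq (D.tmSub φ (app h a))
      (app (D.cast (pi_sub φ A B) (D.tmSub φ h)) (D.tmSub φ a))

/-- For a term `k` of type `Π(A, B){p}` over `Γ.A`, the term `App(k, v)` of type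
`B{p⁺}{⟨id, v⟩} = B` over `Γ.A`. -/
def PiTypes.appVar {F : CwF K} (P : F.PiTypes) {Γ : C} {A : D.Ty Γ} {B : D.Ty (K.ext Γ A)}
    (k : D.Tm (K.ext Γ A) (D.tySub (K.p A) (P.pi A B))) : D.Tm (K.ext Γ A) B :=
  D.cast (by rw [← D.tySub_comp, F.sect_q_lift, D.tySub_id])
    (P.app (D.cast (P.pi_sub (K.p A) A B) k) (K.q A))

/-- Support of dependent function types in the strict sense: the uniqueness rule
`λ(App(h{p}, v)) = h`. -/
def PiTypes.Strict {F : CwF K} (P : F.PiTypes) : Prop :=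
  ∀ {Γ : C} {A : D.Ty Γ} {B : D.Ty (K.ext Γ A)} (h : D.Tm Γ (P.pi A B)),
    P.lam (P.appVar (D.tmSub (K.p A) h)) = h

/-- The uniqueness rule `λ(App(k, v)){p} = k` for all terms `k` of type `Π(A, B){p}` over `Γ.A`,
including those that are not weakenings of terms over `Γ`. -/
def PiTypes.OpenUniq {F : CwF K} (P : F.PiTypes) : Prop :=
  ∀ {Γ : C} {A : D.Ty Γ} {B : D.Ty (K.ext Γ A)}
    (k : D.Tm (K.ext Γ A) (D.tySub (K.p A) (P.pi A B))),
    D.tmSub (K.p A) (P.lam (P.appVar k)) = k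

/-- Support of dependent pair types. -/
structure SigmaTypes (F : CwF K) where
  sigma : {Γ : C} → (A : D.Ty Γ) → D.Ty (K.ext Γ A) → D.Ty Γ
  pairHom : {Γ : C} → (A : D.Ty Γ) → (B : D.Ty (K.ext Γ A)) →
    (K.ext (K.ext Γ A) B ⟶ K.ext Γ (sigma A B))
  elim : {Γ : C} → {A : D.Ty Γ} → {B : D.Ty (K.ext Γ A)} → (P : D.Ty (K.ext Γ (sigma A B))) →
    D.Tm (K.ext (K.ext Γ A) B) (D.tySub (pairHom A B) P) → D.Tm (K.ext Γ (sigma A B)) P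
  elim_pair : ∀ {Γ : C} {A : D.Ty Γ} {B : D.Ty (K.ext Γ A)} (P : D.Ty (K.ext Γ (sigma A B)))
    (f : D.Tm (K.ext (K.ext Γ A) B) (D.tySub (pairHom A B) P)),
    D.tmSub (pairHom A B) (elim P f) = f
  sigma_sub : ∀ {Δ Γ : C} (φ : Δ ⟶ Γ) (A : D.Ty Γ) (B : D.Ty (K.ext Γ A)),
    D.tySub φ (sigma A B) = sigma (D.tySub φ A) (D.tySub (F.lift φ A) B)
  pair_p : ∀ {Γ : C} (A : D.Ty Γ) (B : D.Ty (K.ext Γ A)),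
    pairHom A B ≫ K.p (sigma A B) = K.p B ≫ K.p A
  pair_sub : ∀ {Δ Γ : C} (φ : Δ ⟶ Γ) (A : D.Ty Γ) (B : D.Ty (K.ext Γ A)),
    pairHom (D.tySub φ A) (D.tySub (F.lift φ A) B) ≫
        F.liftOf φ (sigma A B) _ (sigma_sub φ A B).symm =
      F.lift (F.lift φ A) B ≫ pairHom A B
  elim_sub : ∀ {Δ Γ : C} (φ : Δ ⟶ Γ) {A : D.Ty Γ} {B : D.Ty (K.ext Γ A)}
    (P : D.Ty (K.ext Γ (sigma A B)))
    (f : D.Tm (K.ext (K.ext Γ A) B) (D.tySub (pairHom A B) P)),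
    D.tmSub (F.liftOf φ (sigma A B) _ (sigma_sub φ A B).symm) (elim P f) =
      elim (D.tySub (F.liftOf φ (sigma A B) _ (sigma_sub φ A B).symm) P)
        (D.cast (by rw [← D.tySub_comp, ← D.tySub_comp, pair_sub])
          (D.tmSub (F.lift (F.lift φ A) B) f))

/-- Support of dependent pair types in the strict sense. -/
def SigmaTypes.Strict {F : CwF K} (S : F.SigmaTypes) : Prop :=
  ∀ {Γ : C} {A : D.Ty Γ} {B : D.Ty (K.ext Γ A)} (P : D.Ty (K.ext Γ (S.sigma A B)))
    (f : D.Tm (K.ext (K.ext Γ A) B) (D.tySub (S.pairHom A B) P))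
    (g : D.Tm (K.ext Γ (S.sigma A B)) P), D.tmSub (S.pairHom A B) g = f → g = S.elim P f

/-- The term of type `Σ(A, B)` over `Γ` that corresponds to the section
`Pair ∘ ⟨⟨id, a⟩, b⟩ : Γ ⟶ Γ.Σ(A, B)`. -/
def SigmaTypes.mkTm {F : CwF K} (S : F.SigmaTypes) {Γ : C} {A : D.Ty Γ} (B : D.Ty (K.ext Γ A))
    (a : D.Tm Γ A) (b : D.Tm Γ (D.tySub (F.sect a) B)) : D.Tm Γ (S.sigma A B) :=
  D.cast (by
      rw [← D.tySub_comp, Category.assoc, S.pair_p, ← Category.assoc, F.cons_l, F.sect_p,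
        D.tySub_id])
    (D.tmSub (F.pair (F.sect a) B b ≫ S.pairHom A B) (K.q (S.sigma A B)))

/-! ## Universal constructions on dependent objects

Here `F` is the category with families of a semi-cartesian category with dependence, so that
`F.pair` is semi-dependent pairing. -/

/-- A unit dependent object: a dependent object over the terminal object with exactly one
dependent morphism from each object to its reindexing. -/
structure UnitObj (K : Comprehension D) where
  one : D.Ty K.T
  existsUnique : ∀ Γ : C, ∃ f : D.Tm Γ (D.tySub (K.isTerminal.from Γ) one), ∀ g, g = f

/-- A dependent pair space of `A` and `B`, with projections `fst` and `snd`. -/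
structure SigmaSpace {Γ : C} (A : D.Ty Γ) (B : D.Ty (K.ext Γ A)) where
  ty : D.Ty Γ
  fst : D.Tm (K.ext Γ ty) (D.tySub (K.p ty) A)
  snd : D.Tm (K.ext Γ ty) (D.tySub (F.pair (K.p ty) A fst) B)
  dpair : {Δ : C} → (φ : Δ ⟶ Γ) → (g : D.Tm Δ (D.tySub φ A)) →
    D.Tm Δ (D.tySub (F.pair φ A g) B) → D.Tm Δ (D.tySub φ ty)
  fst_dpair : ∀ {Δ : C} (φ : Δ ⟶ Γ) (g : D.Tm Δ (D.tySub φ A))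
    (h : D.Tm Δ (D.tySub (F.pair φ A g) B)), HEq (D.tmSub (F.pair φ ty (dpair φ g h)) fst) g
  snd_dpair : ∀ {Δ : C} (φ : Δ ⟶ Γ) (g : D.Tm Δ (D.tySub φ A))
    (h : D.Tm Δ (D.tySub (F.pair φ A g) B)), HEq (D.tmSub (F.pair φ ty (dpair φ g h)) snd) h
  dpair_unique : ∀ {Δ : C} (φ : Δ ⟶ Γ) (g : D.Tm Δ (D.tySub φ A))
    (h : D.Tm Δ (D.tySub (F.pair φ A g) B)) (k : D.Tm Δ (D.tySub φ ty)),
    HEq (D.tmSub (F.pair φ ty k) fst) g → HEq (D.tmSub (F.pair φ ty k) snd) h →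
      k = dpair φ g h

/-- The morphism `⟨p ∘ p, ⟅v{p}, v⟆⟩ : Γ.A.B ⟶ Γ.Σ(A, B)`. -/
def SigmaSpace.pairHom {F : CwF K} {Γ : C} {A : D.Ty Γ} {B : D.Ty (K.ext Γ A)}
    (S : F.SigmaSpace A B) : K.ext (K.ext Γ A) B ⟶ K.ext Γ S.ty :=
  F.pair (K.p B ≫ K.p A) S.ty
    (S.dpair (K.p B ≫ K.p A)
      (D.cast (D.tySub_comp _ _ _).symm (D.tmSub (K.p B) (K.q A)))
      (D.cast (congrArg (fun m => D.tySub m B) (F.eq_pair_proj B)) (K.q B)))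

/-- A family of dependent pair spaces is coherent if it is stable under reindexing. -/
structure SigmaCoherent
    (S : {Γ : C} → (A : D.Ty Γ) → (B : D.Ty (K.ext Γ A)) → F.SigmaSpace A B) : Prop where
  ty_sub : ∀ {Δ Γ : C} (φ : Δ ⟶ Γ) (A : D.Ty Γ) (B : D.Ty (K.ext Γ A)),
    D.tySub φ (S A B).ty = (S (D.tySub φ A) (D.tySub (F.lift φ A) B)).ty
  fst_sub : ∀ {Δ Γ : C} (φ : Δ ⟶ Γ) (A : D.Ty Γ) (B : D.Ty (K.ext Γ A)),
    HEq (D.tmSub (F.liftOf φ (S A B).ty _ (ty_sub φ A B).symm) (S A B).fst)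
      (S (D.tySub φ A) (D.tySub (F.lift φ A) B)).fst
  snd_sub : ∀ {Δ Γ : C} (φ : Δ ⟶ Γ) (A : D.Ty Γ) (B : D.Ty (K.ext Γ A)),
    HEq (D.tmSub (F.liftOf φ (S A B).ty _ (ty_sub φ A B).symm) (S A B).snd)
      (S (D.tySub φ A) (D.tySub (F.lift φ A) B)).snd

theorem sect_lift_ty {Γ : C} (A P : D.Ty Γ) (l : D.Tm Γ P) :
    A = D.tySub (F.sect l) (D.tySub (K.p P) A) := by
  rw [← D.tySub_comp, F.sect_p, D.tySub_id]

/-- The property that the dependent object `P` over `Γ`, with the dependent evaluation `dev` from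
`Γ.P.A{p}` to `B{p⁺}`, is a pseudo-dependent map space from `A` to `B`: each dependent morphism
`f` from `Γ.A` to `B` has a unique currying `curry f`. -/
structure PseudoPi {Γ : C} (A : D.Ty Γ) (B : D.Ty (K.ext Γ A)) (P : D.Ty Γ)
    (dev : D.Tm (K.ext (K.ext Γ P) (D.tySub (K.p P) A)) (D.tySub (F.lift (K.p P) A) B)) where
  curry : D.Tm (K.ext Γ A) B → D.Tm Γ P
  dev_curry : ∀ f : D.Tm (K.ext Γ A) B,
    HEq (D.tmSub (F.liftOf (F.sect (curry f)) (D.tySub (K.p P) A) A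
      (F.sect_lift_ty A P (curry f))) dev) f
  curry_unique : ∀ (f : D.Tm (K.ext Γ A) B) (l : D.Tm Γ P),
    HEq (D.tmSub (F.liftOf (F.sect l) (D.tySub (K.p P) A) A (F.sect_lift_ty A P l)) dev) f →
      l = curry f

theorem devMap_ty {Δ Γ : C} (φ : Δ ⟶ Γ) (A P : D.Ty Γ) (P' : D.Ty Δ) (hP : P' = D.tySub φ P) :
    D.tySub (K.p P') (D.tySub φ A) = D.tySub (F.liftOf φ P P' hP) (D.tySub (K.p P) A) := by
  rw [← D.tySub_comp, ← D.tySub_comp, F.liftOf_p]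

/-- The morphism `φ⁺⁺ : Δ.P'.A{φ}{p} ⟶ Γ.P.A{p}` induced by `φ : Δ ⟶ Γ`, where `P' = P{φ}`. -/
def devMap {Δ Γ : C} (φ : Δ ⟶ Γ) (A P : D.Ty Γ) (P' : D.Ty Δ) (hP : P' = D.tySub φ P) :
    K.ext (K.ext Δ P') (D.tySub (K.p P') (D.tySub φ A)) ⟶ K.ext (K.ext Γ P) (D.tySub (K.p P) A) :=
  F.liftOf (F.liftOf φ P P' hP) (D.tySub (K.p P) A) _ (F.devMap_ty φ A P P' hP)

theorem devMap_lift {Δ Γ : C} (φ : Δ ⟶ Γ) (A P : D.Ty Γ) (P' : D.Ty Δ)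
    (hP : P' = D.tySub φ P) :
    F.devMap φ A P P' hP ≫ F.lift (K.p P) A =
      F.lift (K.p P') (D.tySub φ A) ≫ F.lift φ A := by
  apply F.hom_ext
  · rw [Category.assoc, F.lift_p, ← Category.assoc, devMap, F.liftOf_p, Category.assoc,
      F.liftOf_p, Category.assoc, F.lift_p, ← Category.assoc, ← Category.assoc, F.lift_p]
  · refine (tmSub_comp_q _ _ ?_ (F.liftOf_q _ _ _ rfl)).trans ((F.liftOf_q _ _ _ _).trans
      ((tmSub_comp_q _ _ ?_ (F.liftOf_q _ _ _ rfl)).trans (F.liftOf_q _ _ _ rfl)).symm)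
    · rw [F.liftOf_p, D.tySub_comp]
    · rw [F.liftOf_p, D.tySub_comp]

/-- The reindexing along `φ` of a dependent evaluation. -/
def devSub {Δ Γ : C} (φ : Δ ⟶ Γ) {A : D.Ty Γ} {B : D.Ty (K.ext Γ A)} {P : D.Ty Γ}
    (dev : D.Tm (K.ext (K.ext Γ P) (D.tySub (K.p P) A)) (D.tySub (F.lift (K.p P) A) B)) :
    D.Tm (K.ext (K.ext Δ (D.tySub φ P)) (D.tySub (K.p (D.tySub φ P)) (D.tySub φ A)))
      (D.tySub (F.lift (K.p (D.tySub φ P)) (D.tySub φ A)) (D.tySub (F.lift φ A) B)) :=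
  D.cast ((D.tySub_comp _ _ B).symm.trans ((congrArg (fun m => D.tySub m B)
      (F.devMap_lift φ A P (D.tySub φ P) rfl)).trans (D.tySub_comp _ _ B)))
    (D.tmSub (F.devMap φ A P (D.tySub φ P) rfl) dev)

theorem pair_lift_ty {Δ Γ : C} (φ : Δ ⟶ Γ) (A P : D.Ty Γ) (k : D.Tm Δ (D.tySub φ P)) :
    D.tySub φ A = D.tySub (F.pair φ P k) (D.tySub (K.p P) A) := by
  rw [← D.tySub_comp, F.cons_l]

theorem liftOf_pair_lift {Δ Γ : C} (φ : Δ ⟶ Γ) (A P : D.Ty Γ) (k : D.Tm Δ (D.tySub φ P)) :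
    F.liftOf (F.pair φ P k) (D.tySub (K.p P) A) (D.tySub φ A) (F.pair_lift_ty φ A P k) ≫
      F.lift (K.p P) A = F.lift φ A := by
  apply F.hom_ext
  · rw [Category.assoc, F.lift_p, ← Category.assoc, F.liftOf_p, Category.assoc, F.cons_l,
      F.lift_p]
  · refine (tmSub_comp_q _ _ ?_ (F.liftOf_q _ _ _ rfl)).trans ((F.liftOf_q _ _ _ _).trans
      (F.liftOf_q _ _ _ rfl).symm)
    rw [F.liftOf_p, D.tySub_comp]

/-- A dependent map space from `A` to `B`, with its dependent evaluation `dev`: a pseudo-dependent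
map space all of whose weakenings along `p : Γ.Z ⟶ Γ` are pseudo-dependent map spaces, with
the two additional equations for their curryings. -/
structure PiSpace {Γ : C} (A : D.Ty Γ) (B : D.Ty (K.ext Γ A)) where
  ty : D.Ty Γ
  dev : D.Tm (K.ext (K.ext Γ ty) (D.tySub (K.p ty) A)) (D.tySub (F.lift (K.p ty) A) B)
  pseudo : F.PseudoPi A B ty dev
  pseudo_wk : (Z : D.Ty Γ) → F.PseudoPi (D.tySub (K.p Z) A) (D.tySub (F.lift (K.p Z) A) B)
    (D.tySub (K.p Z) ty) (F.devSub (K.p Z) dev)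
  dev_curry_wk : ∀ (Z : D.Ty Γ)
    (h : D.Tm (K.ext (K.ext Γ Z) (D.tySub (K.p Z) A)) (D.tySub (F.lift (K.p Z) A) B)),
    HEq (D.tmSub (F.liftOf (F.pair (K.p Z) ty ((pseudo_wk Z).curry h)) (D.tySub (K.p ty) A)
      (D.tySub (K.p Z) A) (F.pair_lift_ty _ _ _ _)) dev) h
  curry_wk_nat : ∀ (Z Y : D.Ty Γ)
    (h : D.Tm (K.ext (K.ext Γ Z) (D.tySub (K.p Z) A)) (D.tySub (F.lift (K.p Z) A) B))
    (g : D.Tm (K.ext Γ Y) (D.tySub (K.p Y) Z)),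
    HEq
      ((pseudo_wk Y).curry
        (D.cast (by rw [← D.tySub_comp, F.liftOf_pair_lift])
          (D.tmSub (F.liftOf (F.pair (K.p Y) Z g) (D.tySub (K.p Z) A) (D.tySub (K.p Y) A)
            (F.pair_lift_ty _ _ _ _)) h)))
      (D.tmSub (F.pair (K.p Y) Z g) ((pseudo_wk Z).curry h))

/-- A family of dependent map spaces is coherent if it is stable under reindexing. -/
structure PiCoherent
    (P : {Γ : C} → (A : D.Ty Γ) → (B : D.Ty (K.ext Γ A)) → F.PiSpace A B) : Prop where
  ty_sub : ∀ {Δ Γ : C} (φ : Δ ⟶ Γ) (A : D.Ty Γ) (B : D.Ty (K.ext Γ A)),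
    D.tySub φ (P A B).ty = (P (D.tySub φ A) (D.tySub (F.lift φ A) B)).ty
  dev_sub : ∀ {Δ Γ : C} (φ : Δ ⟶ Γ) (A : D.Ty Γ) (B : D.Ty (K.ext Γ A)),
    HEq (D.tmSub (F.devMap φ A (P A B).ty _ (ty_sub φ A B).symm) (P A B).dev)
      (P (D.tySub φ A) (D.tySub (F.lift φ A) B)).dev

end CwF

/-- A strict cartesian closed category with dependence on `C`: a category with dependence with a
specified terminal object, specified semi-dependent pair spaces, a unit dependent object, and
coherent families of dependent pair spaces and of dependent map spaces. -/
structure StrictCCCwD (C : Type u) [Category.{v} C] where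
  D : CwD.{w₂, w₁} C
  K : Comprehension D
  semi : SemiCartesian K
  unit : CwF.UnitObj K
  sigma : {Γ : C} → (A : D.Ty Γ) → (B : D.Ty (K.ext Γ A)) → semi.toCwF.SigmaSpace A B
  sigma_coherent : semi.toCwF.SigmaCoherent sigma
  pi : {Γ : C} → (A : D.Ty Γ) → (B : D.Ty (K.ext Γ A)) → semi.toCwF.PiSpace A B
  pi_coherent : semi.toCwF.PiCoherent pi

/-- The category with families induced by a strict cartesian closed category with dependence. -/
def StrictCCCwD.cwf (S : StrictCCCwD.{w₂, w₁} C) : CwF S.K := S.semi.toCwF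

/-- The equation `π₂{π₁} = π₂` between the two second projections on `Γ.A.A{π₁}`. -/
def StrictCCCwD.ProjEq (S : StrictCCCwD.{w₂, w₁} C) : Prop :=
  ∀ {Γ : C} (A : S.D.Ty Γ),
    S.D.tmSub (S.K.p (S.D.tySub (S.K.p A) A)) (S.K.q A) = S.K.q (S.D.tySub (S.K.p A) A)

/-! ## The type theory MLTT(1, Π, Σ)

Expressions are taken modulo α-equivalence, in de Bruijn style: the variable `var n` refers to
the `n`-th binder counted from the inside. -/

/-- Types. In `pi A B` and `sigma A B` one variable is bound in `B`. -/
inductive PreTy : Type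
  | one : PreTy
  | pi : PreTy → PreTy → PreTy
  | sigma : PreTy → PreTy → PreTy

/-- Terms. `lam A b` is `λ x^A. b`, and `elim A B T g t` is
`R^Σ_{[z : Σ_{x : A} B] T}([x : A, y : B] g, t)`. -/
inductive PreTm : Type
  | var : ℕ → PreTm
  | star : PreTm
  | lam : PreTy → PreTm → PreTm
  | app : PreTm → PreTm → PreTm
  | pair : PreTm → PreTm → PreTm
  | elim : PreTy → PreTy → PreTy → PreTm → PreTm → PreTm

/-- Extension of a renaming under a binder. -/
def upRen (ρ : ℕ → ℕ) : ℕ → ℕ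
  | 0 => 0
  | n + 1 => ρ n + 1

/-- Renaming of variables in types. -/
def PreTy.ren : PreTy → (ℕ → ℕ) → PreTy
  | .one, _ => .one
  | .pi A B, ρ => .pi (A.ren ρ) (B.ren (upRen ρ))
  | .sigma A B, ρ => .sigma (A.ren ρ) (B.ren (upRen ρ))

/-- Renaming of variables in terms. -/
def PreTm.ren : PreTm → (ℕ → ℕ) → PreTm
  | .var n, ρ => .var (ρ n)
  | .star, _ => .star
  | .lam A b, ρ => .lam (A.ren ρ) (b.ren (upRen ρ))
  | .app f a, ρ => .app (f.ren ρ) (a.ren ρ)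
  | .pair a b, ρ => .pair (a.ren ρ) (b.ren ρ)
  | .elim A B T g t, ρ => .elim (A.ren ρ) (B.ren (upRen ρ)) (T.ren (upRen ρ))
      (g.ren (upRen (upRen ρ))) (t.ren ρ)

/-- Extension of a substitution under a binder. -/
def upSub (σ : ℕ → PreTm) : ℕ → PreTm
  | 0 => .var 0
  | n + 1 => (σ n).ren Nat.succ

/-- Capture-free simultaneous substitution in types. -/
def PreTy.sub : PreTy → (ℕ → PreTm) → PreTy
  | .one, _ => .one
  | .pi A B, σ => .pi (A.sub σ) (B.sub (upSub σ))
  | .sigma A B, σ => .sigma (A.sub σ) (B.sub (upSub σ))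

/-- Capture-free simultaneous substitution in terms. -/
def PreTm.sub : PreTm → (ℕ → PreTm) → PreTm
  | .var n, σ => σ n
  | .star, _ => .star
  | .lam A b, σ => .lam (A.sub σ) (b.sub (upSub σ))
  | .app f a, σ => .app (f.sub σ) (a.sub σ)
  | .pair a b, σ => .pair (a.sub σ) (b.sub σ)
  | .elim A B T g t, σ => .elim (A.sub σ) (B.sub (upSub σ)) (T.sub (upSub σ))
      (g.sub (upSub (upSub σ))) (t.sub σ)

/-- Weakening by a fresh innermost variable. -/
abbrev PreTy.wk (A : PreTy) : PreTy := A.ren Nat.succ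

/-- The substitution `[a/x]` for the innermost variable `x`. -/
def inst (a : PreTm) : ℕ → PreTm
  | 0 => a
  | n + 1 => .var n

/-- The substitution `[a/x, b/y]` for the two innermost variables, of which `y` is the inner. -/
def inst₂ (a b : PreTm) : ℕ → PreTm
  | 0 => b
  | 1 => a
  | n + 2 => .var n

/-- The substitution `[⟨x, y⟩/z]` from expressions over `Γ, z` to expressions over `Γ, x, y`. -/
def pairSub : ℕ → PreTm
  | 0 => .pair (.var 1) (.var 0)
  | n + 1 => .var (n + 2)

/-- The first projection `π₁(t)` for `t : Σ_{x : A} B`. -/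
def PreTm.fst (A B : PreTy) (t : PreTm) : PreTm := .elim A B A.wk (.var 1) t

/-- The substitution `[π₁(z)/x]` from expressions over `Γ, x : A` to expressions over
`Γ, z : Σ_{x : A} B`. -/
def fstSub (A B : PreTy) : ℕ → PreTm
  | 0 => PreTm.fst A.wk (B.ren (upRen Nat.succ)) (.var 0)
  | n + 1 => .var (n + 1)

/-- The second projection `π₂(t)` for `t : Σ_{x : A} B`. -/
def PreTm.snd (A B : PreTy) (t : PreTm) : PreTm := .elim A B (B.sub (fstSub A B)) (.var 0) t

/-- Contexts. The head of the list is the variable declared last, so that `A :: Γ` is the context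
`Γ, x : A` and `Δ ++ Γ` is the context `Γ, Δ`. -/
abbrev Ctx := List PreTy

/-- Renaming in a context `Δ` that extends another one. -/
def Ctx.ren : Ctx → (ℕ → ℕ) → Ctx
  | [], _ => []
  | A :: Δ, ρ => A.ren (upRen^[Δ.length] ρ) :: Ctx.ren Δ ρ

/-- Substitution in a context `Δ` that extends another one. -/
def Ctx.sub : Ctx → (ℕ → PreTm) → Ctx
  | [], _ => []
  | A :: Δ, σ => A.sub (upSub^[Δ.length] σ) :: Ctx.sub Δ σ

/-- The right-hand sides of judgements: being a context, being a type, being a term of a type,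
equality of types, equality of terms of a type. -/
inductive Rhs : Type
  | ctx : Rhs
  | ty : PreTy → Rhs
  | tm : PreTm → PreTy → Rhs
  | tyEq : PreTy → PreTy → Rhs
  | tmEq : PreTm → PreTm → PreTy → Rhs

/-- Renaming in a right-hand side. -/
def Rhs.ren : Rhs → (ℕ → ℕ) → Rhs
  | .ctx, _ => .ctx
  | .ty A, ρ => .ty (A.ren ρ)
  | .tm a A, ρ => .tm (a.ren ρ) (A.ren ρ)
  | .tyEq A B, ρ => .tyEq (A.ren ρ) (B.ren ρ)
  | .tmEq a b A, ρ => .tmEq (a.ren ρ) (b.ren ρ) (A.ren ρ)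

/-- Substitution in a right-hand side. -/
def Rhs.sub : Rhs → (ℕ → PreTm) → Rhs
  | .ctx, _ => .ctx
  | .ty A, σ => .ty (A.sub σ)
  | .tm a A, σ => .tm (a.sub σ) (A.sub σ)
  | .tyEq A B, σ => .tyEq (A.sub σ) (B.sub σ)
  | .tmEq a b A, σ => .tmEq (a.sub σ) (b.sub σ) (A.sub σ)

/-- Judgements: `on Γ J` is `Γ ⊢ J` (and `⊢ Γ ctx` if `J` is `ctx`), and `ctxEq Γ Δ` is
`⊢ Γ = Δ ctx`. -/
inductive Judgement : Type
  | on : Ctx → Rhs → Judgement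
  | ctxEq : Ctx → Ctx → Judgement

open Judgement Rhs in
/-- The derivable judgements of MLTT(1, Π, Σ). -/
inductive Derivable : Judgement → Prop
  -- contexts
  | ctx_emp : Derivable (on [] ctx)
  | ctx_ext {Γ A} : Derivable (on Γ (ty A)) → Derivable (on (A :: Γ) ctx)
  | ctx_extEq {Γ Δ A B} : Derivable (ctxEq Γ Δ) → Derivable (on Γ (tyEq A B)) →
      Derivable (ctxEq (A :: Γ) (B :: Δ))
  -- structural rules
  | var {Γ n A} : Derivable (on Γ ctx) → Γ[n]? = some A →
      Derivable (on Γ (tm (.var n) (A.ren (fun k => k + (n + 1)))))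
  | ctx_eqRefl {Γ} : Derivable (on Γ ctx) → Derivable (ctxEq Γ Γ)
  | ctx_eqSymm {Γ Δ} : Derivable (ctxEq Γ Δ) → Derivable (ctxEq Δ Γ)
  | ctx_eqTrans {Γ Δ Θ} : Derivable (ctxEq Γ Δ) → Derivable (ctxEq Δ Θ) → Derivable (ctxEq Γ Θ)
  | ty_eqRefl {Γ A} : Derivable (on Γ (ty A)) → Derivable (on Γ (tyEq A A))
  | ty_eqSymm {Γ A B} : Derivable (on Γ (tyEq A B)) → Derivable (on Γ (tyEq B A))
  | ty_eqTrans {Γ A B A'} : Derivable (on Γ (tyEq A B)) → Derivable (on Γ (tyEq B A')) →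
      Derivable (on Γ (tyEq A A'))
  | tm_eqRefl {Γ a A} : Derivable (on Γ (tm a A)) → Derivable (on Γ (tmEq a a A))
  | tm_eqSymm {Γ a b A} : Derivable (on Γ (tmEq a b A)) → Derivable (on Γ (tmEq b a A))
  | tm_eqTrans {Γ a b c A} : Derivable (on Γ (tmEq a b A)) → Derivable (on Γ (tmEq b c A)) →
      Derivable (on Γ (tmEq a c A))
  | ty_con {Γ Δ A} : Derivable (ctxEq Γ Δ) → Derivable (on Γ (ty A)) → Derivable (on Δ (ty A))
  | tm_con {Γ Δ a A B} : Derivable (on Γ (tm a A)) → Derivable (ctxEq Γ Δ) →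
      Derivable (on Γ (tyEq A B)) → Derivable (on Δ (tm a B))
  | ty_eqCon {Γ Δ A B} : Derivable (ctxEq Γ Δ) → Derivable (on Γ (tyEq A B)) →
      Derivable (on Δ (tyEq A B))
  | tm_eqCon {Γ Δ a b A B} : Derivable (on Γ (tmEq a b A)) → Derivable (ctxEq Γ Δ) →
      Derivable (on Γ (tyEq A B)) → Derivable (on Δ (tmEq a b B))
  | weak {Γ Δ A J} : Derivable (on (Δ ++ Γ) J) → Derivable (on Γ (ty A)) →
      Derivable (on (Ctx.ren Δ Nat.succ ++ A :: Γ) (J.ren (upRen^[Δ.length] Nat.succ)))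
  | subst {Γ Δ A a J} : Derivable (on (Δ ++ A :: Γ) J) → Derivable (on Γ (tm a A)) →
      Derivable (on (Ctx.sub Δ (inst a) ++ Γ) (J.sub (upSub^[Δ.length] (inst a))))
  -- unit type
  | one_form {Γ} : Derivable (on Γ ctx) → Derivable (on Γ (ty .one))
  | one_intro {Γ} : Derivable (on Γ ctx) → Derivable (on Γ (tm .star .one))
  | one_uniq {Γ t} : Derivable (on Γ (tm t .one)) → Derivable (on Γ (tmEq t .star .one))
  -- dependent function types
  | pi_form {Γ A B} : Derivable (on Γ (ty A)) → Derivable (on (A :: Γ) (ty B)) →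
      Derivable (on Γ (ty (.pi A B)))
  | pi_formEq {Γ A A' B B'} : Derivable (on Γ (tyEq A A')) →
      Derivable (on (A :: Γ) (tyEq B B')) → Derivable (on Γ (tyEq (.pi A B) (.pi A' B')))
  | pi_intro {Γ A B b} : Derivable (on (A :: Γ) (tm b B)) →
      Derivable (on Γ (tm (.lam A b) (.pi A B)))
  | pi_introEq {Γ A A' B b b'} : Derivable (on Γ (tyEq A A')) →
      Derivable (on (A :: Γ) (tmEq b b' B)) →
      Derivable (on Γ (tmEq (.lam A b) (.lam A' b') (.pi A B)))
  | pi_elim {Γ A B f a} : Derivable (on Γ (tm f (.pi A B))) → Derivable (on Γ (tm a A)) →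
      Derivable (on Γ (tm (.app f a) (B.sub (inst a))))
  | pi_elimEq {Γ A B f f' a a'} : Derivable (on Γ (tmEq f f' (.pi A B))) →
      Derivable (on Γ (tmEq a a' A)) →
      Derivable (on Γ (tmEq (.app f a) (.app f' a') (B.sub (inst a))))
  | pi_comp {Γ A B b a} : Derivable (on (A :: Γ) (tm b B)) → Derivable (on Γ (tm a A)) →
      Derivable (on Γ (tmEq (.app (.lam A b) a) (b.sub (inst a)) (B.sub (inst a))))
  | pi_uniq {Γ A B f} : Derivable (on Γ (tm f (.pi A B))) →
      Derivable (on Γ (tmEq (.lam A (.app (f.ren Nat.succ) (.var 0))) f (.pi A B)))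
  -- dependent pair types
  | sigma_form {Γ A B} : Derivable (on Γ (ty A)) → Derivable (on (A :: Γ) (ty B)) →
      Derivable (on Γ (ty (.sigma A B)))
  | sigma_formEq {Γ A A' B B'} : Derivable (on Γ (tyEq A A')) →
      Derivable (on (A :: Γ) (tyEq B B')) → Derivable (on Γ (tyEq (.sigma A B) (.sigma A' B')))
  | sigma_intro {Γ A B a b} : Derivable (on (A :: Γ) (ty B)) → Derivable (on Γ (tm a A)) →
      Derivable (on Γ (tm b (B.sub (inst a)))) → Derivable (on Γ (tm (.pair a b) (.sigma A B)))
  | sigma_introEq {Γ A B a a' b b'} : Derivable (on (A :: Γ) (ty B)) →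
      Derivable (on Γ (tmEq a a' A)) → Derivable (on Γ (tmEq b b' (B.sub (inst a)))) →
      Derivable (on Γ (tmEq (.pair a b) (.pair a' b') (.sigma A B)))
  | sigma_elim {Γ A B T g t} : Derivable (on (.sigma A B :: Γ) (ty T)) →
      Derivable (on (B :: A :: Γ) (tm g (T.sub pairSub))) →
      Derivable (on Γ (tm t (.sigma A B))) →
      Derivable (on Γ (tm (.elim A B T g t) (T.sub (inst t))))
  | sigma_elimEq {Γ A A' B B' T T' g g' t t'} : Derivable (on Γ (tyEq A A')) →
      Derivable (on (A :: Γ) (tyEq B B')) → Derivable (on (.sigma A B :: Γ) (tyEq T T')) →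
      Derivable (on (B :: A :: Γ) (tmEq g g' (T.sub pairSub))) →
      Derivable (on Γ (tmEq t t' (.sigma A B))) →
      Derivable (on Γ (tmEq (.elim A B T g t) (.elim A' B' T' g' t') (T.sub (inst t))))
  | sigma_comp {Γ A B T g a b} : Derivable (on (.sigma A B :: Γ) (ty T)) →
      Derivable (on (B :: A :: Γ) (tm g (T.sub pairSub))) → Derivable (on Γ (tm a A)) →
      Derivable (on Γ (tm b (B.sub (inst a)))) →
      Derivable (on Γ (tmEq (.elim A B T g (.pair a b)) (g.sub (inst₂ a b))
        (T.sub (inst (.pair a b)))))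
  | sigma_uniq {Γ A B t} : Derivable (on Γ (tm t (.sigma A B))) →
      Derivable (on Γ (tmEq (.pair (PreTm.fst A B t) (PreTm.snd A B t)) t (.sigma A B)))

/-! ## Interpretation in categories with families

The interpretation is given as a relation between expressions and their denotations, with one
clause for each rule of the theory. -/

section Interpretation

variable {D : CwD.{w₂, w₁} C} {K : Comprehension D} {F : CwF K}
  (U : F.UnitType) (Sg : F.SigmaTypes) (P : F.PiTypes)

/-- `TyInterp U Sg P Γ X A α`: the type `A` in the context `Γ`, whose interpretation is `X`, is
interpreted by `α`. -/
inductive TyInterp : Ctx → (X : C) → PreTy → D.Ty X → Prop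
  | con {Γ Δ X A α} : Derivable (.ctxEq Γ Δ) → TyInterp Γ X A α → TyInterp Δ X A α
  | one {Γ X} : TyInterp Γ X .one (U.one X)
  | pi {Γ X A B α β} : TyInterp Γ X A α → TyInterp (A :: Γ) (K.ext X α) B β →
      TyInterp Γ X (.pi A B) (P.pi α β)
  | sigma {Γ X A B α β} : TyInterp Γ X A α → TyInterp (A :: Γ) (K.ext X α) B β →
      TyInterp Γ X (.sigma A B) (Sg.sigma α β)

/-- `CtxInterp U Sg P Γ X`: the context `Γ` is interpreted by the object `X`. -/
inductive CtxInterp : Ctx → C → Prop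
  | emp : CtxInterp [] K.T
  | ext {Γ X A α} : CtxInterp Γ X → TyInterp U Sg P Γ X A α →
      CtxInterp (A :: Γ) (K.ext X α)

/-- `TmInterp U Sg P Γ X a A α u`: the term `a` of type `A` in the context `Γ`, where `Γ` and `A`
are interpreted by `X` and `α`, is interpreted by `u`. -/
inductive TmInterp : Ctx → (X : C) → PreTm → PreTy → (α : D.Ty X) → D.Tm X α → Prop
  | con {Γ Δ X a A B α u} : Derivable (.ctxEq Γ Δ) → Derivable (.on Γ (.tyEq A B)) →
      TmInterp Γ X a A α u → TmInterp Δ X a B α u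
  | var_zero {Γ X A α} : CtxInterp U Sg P Γ X → TyInterp U Sg P Γ X A α →
      TmInterp (A :: Γ) (K.ext X α) (.var 0) A.wk (D.tySub (K.p α) α) (K.q α)
  | var_succ {Γ X n A α u B β} : CtxInterp U Sg P Γ X → TmInterp Γ X (.var n) A α u →
      TyInterp U Sg P Γ X B β →
      TmInterp (B :: Γ) (K.ext X β) (.var (n + 1)) A.wk (D.tySub (K.p β) α)
        (D.tmSub (K.p β) u)
  | star {Γ X} : TmInterp Γ X .star .one (U.one X) (U.star X)
  | lam {Γ X A B b α β u} : TyInterp U Sg P Γ X A α →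
      TmInterp (A :: Γ) (K.ext X α) b B β u →
      TmInterp Γ X (.lam A b) (.pi A B) (P.pi α β) (P.lam u)
  | app {Γ X A B f a α β u w} : TyInterp U Sg P Γ X A α →
      TyInterp U Sg P (A :: Γ) (K.ext X α) B β → TmInterp Γ X f (.pi A B) (P.pi α β) u →
      TmInterp Γ X a A α w →
      TmInterp Γ X (.app f a) (B.sub (inst a)) (D.tySub (F.sect w) β) (P.app u w)
  | pair {Γ X A B a b α β u w} : TyInterp U Sg P (A :: Γ) (K.ext X α) B β →
      TmInterp Γ X a A α u → TmInterp Γ X b (B.sub (inst a)) (D.tySub (F.sect u) β) w →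
      TmInterp Γ X (.pair a b) (.sigma A B) (Sg.sigma α β) (Sg.mkTm β u w)
  | elim {Γ X A B T g t α β τ u w} : TyInterp U Sg P Γ X A α →
      TyInterp U Sg P (A :: Γ) (K.ext X α) B β →
      TyInterp U Sg P (.sigma A B :: Γ) (K.ext X (Sg.sigma α β)) T τ →
      TmInterp (B :: A :: Γ) (K.ext (K.ext X α) β) g (T.sub pairSub)
        (D.tySub (Sg.pairHom α β) τ) u →
      TmInterp Γ X t (.sigma A B) (Sg.sigma α β) w →
      TmInterp Γ X (.elim A B T g t) (T.sub (inst t)) (D.tySub (F.sect w) τ)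
        (D.tmSub (F.sect w) (Sg.elim τ u))

/-- The denotations of a context. -/
def CtxDen (Γ : Ctx) (X : C) : Prop := CtxInterp U Sg P Γ X

/-- The denotations of a type in context, as pairs of an object and a type over it. -/
def TyDen (Γ : Ctx) (A : PreTy) (s : Σ X : C, D.Ty X) : Prop :=
  CtxInterp U Sg P Γ s.1 ∧ TyInterp U Sg P Γ s.1 A s.2

/-- The denotations of a term in context, as triples of an object, a type and a term. -/
def TmDen (Γ : Ctx) (a : PreTm) (A : PreTy) (s : Σ X : C, Σ α : D.Ty X, D.Tm X α) : Prop :=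
  CtxInterp U Sg P Γ s.1 ∧ TyInterp U Sg P Γ s.1 A s.2.1 ∧
    TmInterp U Sg P Γ s.1 a A s.2.1 s.2.2

/-- Soundness of the interpretation: every derivable context, type and term has exactly one
denotation, and judgementally equal contexts, types and terms have the same denotation. -/
structure Sound : Prop where
  ctx : ∀ {Γ}, Derivable (.on Γ .ctx) → ∃! X, CtxDen U Sg P Γ X
  ty : ∀ {Γ A}, Derivable (.on Γ (.ty A)) → ∃! s, TyDen U Sg P Γ A s
  tm : ∀ {Γ a A}, Derivable (.on Γ (.tm a A)) → ∃! s, TmDen U Sg P Γ a A s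
  ctxEq : ∀ {Γ Γ'}, Derivable (.ctxEq Γ Γ') →
    ∃ X, (∀ Y, CtxDen U Sg P Γ Y ↔ Y = X) ∧ (∀ Y, CtxDen U Sg P Γ' Y ↔ Y = X)
  tyEq : ∀ {Γ A A'}, Derivable (.on Γ (.tyEq A A')) →
    ∃ s, (∀ r, TyDen U Sg P Γ A r ↔ r = s) ∧ (∀ r, TyDen U Sg P Γ A' r ↔ r = s)
  tmEq : ∀ {Γ a a' A}, Derivable (.on Γ (.tmEq a a' A)) →
    ∃ s, (∀ r, TmDen U Sg P Γ a A r ↔ r = s) ∧ (∀ r, TmDen U Sg P Γ a' A r ↔ r = s)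

end Interpretation

end DepCat

open DepCat

/-! The universal properties of the D-spaces become invertibility statements. A Σ-space is what
makes the pairing morphism Γ.A.B → Γ.Σ(A,B) an isomorphism, with inverse ⟨⟨p, ϖ₁⟩, ϖ₂⟩
(`SigmaSpace.pairHom_unpair`, `SigmaSpace.unpair_pairHom`). Elimination is substitution along this
inverse, so its computation and uniqueness rules are the two inverse laws. Coherence of the
projections makes the inverse natural, and hence pairing as well.

Evaluating `dev` at a term of a Π-space gives a map `PiSpace.uncurry`, and the pseudo-Π property
says that it is a bijection with inverse Λ. Stability of `dev` makes it natural
(`PiCoherent.uncurry_sub`), so Λ is natural too. With App(h, a) defined as the uncurrying of h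
reindexed along the section of a, the β- and η-rules are again inverse laws. The open uniqueness
rule holds because the projection equation identifies all parallel D-morphisms (`tm_subsingleton`).

For soundness, the decisive point is that the only base type is 1, so no term ever occurs in a type.
Substitution therefore fixes every type expression, each type has a denotation `ty A X` over every
object X, stable under reindexing, and derivable equality of types or contexts is syntactic
identity. Terms can then be interpreted without reference to derivations, by the syntax-directed
relation `Den`. It is single-valued (`Den.unique`) and respects renaming and substitution
(`Den.ren`, `Den.sub`), so induction on derivations yields existence and equality of denotations
(`valid_of_derivable`). Finally `den_of_tmInterp` and `Den.tmInterp` identify `Den` with the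
interpretation by clauses, whose conversion clauses change nothing because the contexts and types
they relate coincide. -/

namespace DepCat

universe w₂ w₁ v u

namespace CwF

variable {C : Type u} [Category.{v} C] {D : CwD.{w₂, w₁} C} {K : Comprehension D} (F : CwF K)

/-! ### Unit types from a unit dependent object -/

/-- The unit types given by a unit dependent object. -/
noncomputable def UnitObj.toUnitType (U : UnitObj K) : F.UnitType where
  one Γ := D.tySub (K.isTerminal.from Γ) U.one
  star Γ := (U.existsUnique Γ).choose
  one_sub φ := by rw [← D.tySub_comp, K.isTerminal.hom_ext (φ ≫ K.isTerminal.from _)]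
  -- After transport along `h` both sides are D-morphisms from Δ into the reindexed unit D-object,
  -- and only one exists.
  star_sub {Δ Γ} φ := by
    have h : D.tySub φ (D.tySub (K.isTerminal.from Γ) U.one) =
        D.tySub (K.isTerminal.from Δ) U.one := by
      rw [← D.tySub_comp, K.isTerminal.hom_ext (φ ≫ K.isTerminal.from _)]
    exact (D.cast_heq h _).symm.trans (heq_of_eq ((U.existsUnique Δ).choose_spec _))

theorem UnitObj.toUnitType_strict (U : UnitObj K) : (U.toUnitType F).Strict :=
  fun {Γ} f => (U.existsUnique Γ).choose_spec f

/-! ### Substitution and extension -/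

theorem tmSub_pair_comp {Θ Δ Γ : C} (ψ : Θ ⟶ Δ) {φ : Δ ⟶ Γ} {A : D.Ty Γ}
    {m : Δ ⟶ K.ext Γ A} (hm : m ≫ K.p A = φ) {g : D.Tm Δ (D.tySub φ A)}
    (h : HEq (D.tmSub m (K.q A)) g) : HEq (D.tmSub (ψ ≫ m) (K.q A)) (D.tmSub ψ g) :=
  tmSub_comp_q ψ m (by rw [hm]) h

/-- Naturality of sections. The type `A'` is kept apart from `A{φ}` because the specified spaces
over Δ equal the reindexed ones only propositionally. -/
theorem sect_comp_liftOf {Δ Γ : C} (φ : Δ ⟶ Γ) {A : D.Ty Γ} {A' : D.Ty Δ}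
    (h : A' = D.tySub φ A) (a : D.Tm Γ A) (a' : D.Tm Δ A') (ha : HEq a' (D.tmSub φ a)) :
    F.sect a' ≫ F.liftOf φ A A' h = φ ≫ F.sect a := by
  apply F.hom_ext
  · rw [Category.assoc, F.liftOf_p, ← Category.assoc, F.sect_p, Category.id_comp, Category.assoc,
      F.sect_p, Category.comp_id]
  · refine (tmSub_comp_q _ _ ?_ (F.liftOf_q _ _ _ _)).trans ((F.sect_q _).trans (ha.trans
      (tmSub_comp_q _ _ ?_ (F.sect_q _)).symm))
    · rw [F.liftOf_p, D.tySub_comp, h]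
    · rw [F.sect_p, D.tySub_id]

/-! ### Dependent pair types from dependent pair spaces -/

section Sigma

variable {F} {Γ : C} {A : D.Ty Γ} {B : D.Ty (K.ext Γ A)} (S : F.SigmaSpace A B)

/-- The morphism `⟨⟨p, fst⟩, snd⟩ : Γ.Σ(A, B) ⟶ Γ.A.B`. -/
def SigmaSpace.unpair : K.ext Γ S.ty ⟶ K.ext (K.ext Γ A) B :=
  F.pair (F.pair (K.p S.ty) A S.fst) B S.snd

theorem SigmaSpace.pairHom_p : S.pairHom ≫ K.p S.ty = K.p B ≫ K.p A := F.cons_l _ _ _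

theorem SigmaSpace.unpair_p_p : S.unpair ≫ K.p B ≫ K.p A = K.p S.ty := by
  rw [← Category.assoc, unpair, F.cons_l, F.cons_l]

/-- The existence half of the Σ-space property: the components of the composite are the projections
of a dependent pair. -/
theorem SigmaSpace.pairHom_unpair : S.pairHom ≫ S.unpair = 𝟙 _ := by
  have h1 : S.pairHom ≫ S.unpair ≫ K.p B = K.p B := by
    rw [unpair, F.cons_l]
    apply F.hom_ext
    · rw [Category.assoc, F.cons_l, S.pairHom_p]
    · refine (tmSub_pair_comp _ (F.cons_l _ _ _) (F.cons_r _ _ _)).trans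
        ((S.fst_dpair _ _ _).trans (D.cast_heq _ _))
  apply F.hom_ext
  · rw [Category.assoc, h1, Category.id_comp]
  · refine (tmSub_pair_comp _ (F.cons_l _ _ _) (F.cons_r _ _ _)).trans
      ((S.snd_dpair _ _ _).trans ((D.cast_heq _ _).trans (D.tmSub_id _).symm))

/-- The uniqueness half of the Σ-space property: a morphism into Γ.Σ(A,B) is determined by its base
and its two projections, which are the components of its composite with `unpair`. -/
theorem SigmaSpace.hom_ext {Δ : C} {m n : Δ ⟶ K.ext Γ S.ty} (h : m ≫ S.unpair = n ≫ S.unpair) :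
    m = n := by
  have key : ∀ (k : Δ ⟶ K.ext Γ S.ty) (φ : Δ ⟶ Γ) (g : D.Tm Δ (D.tySub φ A))
      (hh : D.Tm Δ (D.tySub (F.pair φ A g) B)), k ≫ S.unpair = F.pair (F.pair φ A g) B hh →
      k = F.pair φ S.ty (S.dpair φ g hh) := by
    intro k φ g hh hk
    have hp : k ≫ K.p S.ty = φ := by
      rw [← S.unpair_p_p, ← Category.assoc, hk, ← Category.assoc, F.cons_l, F.cons_l]
    have hk1 : k ≫ F.pair (K.p S.ty) A S.fst = F.pair φ A g := by
      have := congrArg (· ≫ K.p B) hk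
      simpa only [Category.assoc, unpair, F.cons_l] using this
    have hc : D.tySub k (D.tySub (K.p S.ty) S.ty) = D.tySub φ S.ty := by
      rw [← D.tySub_comp, hp]
    have hkk : k = F.pair φ S.ty (D.cast hc (D.tmSub k (K.q S.ty))) := by
      apply F.hom_ext
      · rw [F.cons_l, hp]
      · exact ((F.cons_r _ _ _).trans (D.cast_heq _ _)).symm
    have e := S.dpair_unique φ g hh (D.cast hc (D.tmSub k (K.q S.ty))) ?_ ?_
    · rw [← e]; exact hkk
    · rw [← hkk]
      refine (tmSub_pair_comp k (F.cons_l _ _ _) (F.cons_r _ _ _)).symm.trans ?_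
      rw [hk1]
      exact F.cons_r _ _ _
    · rw [← hkk]
      refine (tmSub_pair_comp k (F.cons_l _ _ _) (F.cons_r _ _ S.snd)).symm.trans ?_
      change HEq (D.tmSub (k ≫ S.unpair) _) _
      rw [hk]
      exact F.cons_r _ _ _
  -- This puts the common composite into the iterated-extension form that `key` expects.
  have e : n ≫ S.unpair = F.pair (F.pair (n ≫ K.p S.ty) A
      (D.cast (D.tySub_comp _ _ _).symm (D.tmSub n S.fst))) B
      (D.cast (by rw [← D.tySub_comp, F.cons_nat]) (D.tmSub n S.snd)) := by
    rw [unpair, F.cons_nat]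
    exact F.pair_congr (F.cons_nat _ _ _ _) ((D.cast_heq _ _).trans (D.cast_heq _ _).symm)
  rw [key m _ _ _ (h.trans e), ← key n _ _ _ e]

/-- A monomorphism with a section is invertible. -/
theorem SigmaSpace.unpair_pairHom : S.unpair ≫ S.pairHom = 𝟙 _ := by
  apply S.hom_ext
  rw [Category.assoc, S.pairHom_unpair, Category.comp_id, Category.id_comp]

end Sigma

section SigmaFamily

variable {F} {S : {Γ : C} → (A : D.Ty Γ) → (B : D.Ty (K.ext Γ A)) → F.SigmaSpace A B}

theorem SigmaCoherent.liftOf_unpair (hS : F.SigmaCoherent S) {Δ Γ : C} (φ : Δ ⟶ Γ) (A : D.Ty Γ)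
    (B : D.Ty (K.ext Γ A)) :
    F.liftOf φ (S A B).ty _ (hS.ty_sub φ A B).symm ≫ (S A B).unpair =
      (S (D.tySub φ A) (D.tySub (F.lift φ A) B)).unpair ≫ F.lift (F.lift φ A) B := by
  have h1 : F.liftOf φ (S A B).ty _ (hS.ty_sub φ A B).symm ≫ F.pair (K.p (S A B).ty) A (S A B).fst =
      F.pair (K.p _) (D.tySub φ A) (S (D.tySub φ A) (D.tySub (F.lift φ A) B)).fst ≫
        F.lift φ A := by
    apply F.hom_ext
    · rw [Category.assoc, F.cons_l, F.liftOf_p, Category.assoc, F.lift_p, ← Category.assoc,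
        F.cons_l]
    · refine (tmSub_pair_comp _ (F.cons_l _ _ _) (F.cons_r _ _ _)).trans ((hS.fst_sub φ A B).trans
        ((tmSub_comp_q _ _ ?_ (F.liftOf_q _ _ _ rfl)).trans (F.cons_r _ _ _)).symm)
      rw [F.liftOf_p, D.tySub_comp]
  apply F.hom_ext
  · rw [Category.assoc, Category.assoc, F.lift_p, SigmaSpace.unpair, F.cons_l, h1,
      SigmaSpace.unpair, ← Category.assoc, F.cons_l]
  · refine (tmSub_pair_comp _ (F.cons_l _ _ _) (F.cons_r _ _ _)).trans ((hS.snd_sub φ A B).trans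
      ((tmSub_comp_q _ _ ?_ (F.liftOf_q _ _ _ rfl)).trans (F.cons_r _ _ _)).symm)
    rw [F.liftOf_p, D.tySub_comp]

/-- Coherence speaks of projections, hence of `unpair`; naturality passes to the inverse. -/
theorem SigmaCoherent.pairHom_liftOf (hS : F.SigmaCoherent S) {Δ Γ : C} (φ : Δ ⟶ Γ) (A : D.Ty Γ)
    (B : D.Ty (K.ext Γ A)) :
    (S (D.tySub φ A) (D.tySub (F.lift φ A) B)).pairHom ≫
        F.liftOf φ (S A B).ty _ (hS.ty_sub φ A B).symm =
      F.lift (F.lift φ A) B ≫ (S A B).pairHom := by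
  apply (S A B).hom_ext
  rw [Category.assoc, hS.liftOf_unpair, ← Category.assoc, SigmaSpace.pairHom_unpair,
    Category.id_comp, Category.assoc, SigmaSpace.pairHom_unpair, Category.comp_id]

/-- The dependent pair types given by a coherent family of dependent pair spaces. -/
def SigmaCoherent.toSigmaTypes (hS : F.SigmaCoherent S) : F.SigmaTypes where
  sigma A B := (S A B).ty
  pairHom A B := (S A B).pairHom
  -- Elimination is reindexing along the inverse of pairing, so every law below reduces to an
  -- equation of morphisms.
  elim {_ A B} P f := D.cast
    (by rw [← D.tySub_comp, SigmaSpace.unpair_pairHom, D.tySub_id]) (D.tmSub (S A B).unpair f)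
  elim_pair {_ A B} P f := by
    refine eq_of_heq ((D.tmSub_congr rfl ?_ (D.cast_heq _ _)).trans
      ((D.tmSub_comp _ _ _).symm.trans
        ((D.tmSub_congr (S A B).pairHom_unpair rfl HEq.rfl).trans (D.tmSub_id _))))
    rw [← D.tySub_comp, SigmaSpace.unpair_pairHom, D.tySub_id]
  sigma_sub := hS.ty_sub
  pair_p A B := (S A B).pairHom_p
  pair_sub := hS.pairHom_liftOf
  elim_sub φ A B P f := by
    refine eq_of_heq ((D.tmSub_congr rfl ?_ (D.cast_heq _ _)).trans
      ((D.tmSub_comp _ _ _).symm.trans ((D.tmSub_congr (hS.liftOf_unpair φ A B) rfl HEq.rfl).trans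
        ((D.tmSub_comp _ _ _).trans ((D.tmSub_congr rfl ?_ (D.cast_heq _ _).symm).trans
          (D.cast_heq _ _).symm)))))
    · rw [← D.tySub_comp, SigmaSpace.unpair_pairHom, D.tySub_id]
    · rw [← D.tySub_comp, ← D.tySub_comp, hS.pairHom_liftOf]

theorem SigmaCoherent.toSigmaTypes_strict (hS : F.SigmaCoherent S) : hS.toSigmaTypes.Strict := by
  rintro Γ A B P _ g rfl
  exact eq_of_heq ((((D.cast_heq _ _).trans (D.tmSub_comp _ _ _).symm).trans
    (D.tmSub_congr (S A B).unpair_pairHom rfl HEq.rfl)).trans (D.tmSub_id _)).symm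

end SigmaFamily

/-! ### Dependent function types from dependent map spaces -/

section PiFamily

theorem liftOf_sect_lift {Γ : C} (A P : D.Ty Γ) (l : D.Tm Γ P) :
    F.liftOf (F.sect l) (D.tySub (K.p P) A) A (F.sect_lift_ty A P l) ≫ F.lift (K.p P) A = 𝟙 _ := by
  apply F.hom_ext
  · rw [Category.assoc, F.lift_p, ← Category.assoc, F.liftOf_p, Category.assoc, F.sect_p,
      Category.id_comp, Category.comp_id]
  · refine (tmSub_comp_q _ _ ?_ (F.liftOf_q _ _ _ rfl)).trans
      ((F.liftOf_q _ _ _ _).trans (D.tmSub_id _).symm)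
    rw [F.liftOf_p, D.tySub_comp]

/-- The naturality of uncurrying, stated for the morphisms along which `dev` is reindexed. -/
theorem liftOf_sect_comp_devMap {Δ Γ : C} (φ : Δ ⟶ Γ) (A P : D.Ty Γ) (P' : D.Ty Δ)
    (hP : P' = D.tySub φ P) (l : D.Tm Γ P) (l' : D.Tm Δ P') (hl : HEq l' (D.tmSub φ l)) :
    F.liftOf (F.sect l') (D.tySub (K.p P') (D.tySub φ A)) (D.tySub φ A)
        (F.sect_lift_ty (D.tySub φ A) P' l') ≫ F.devMap φ A P P' hP =
      F.lift φ A ≫ F.liftOf (F.sect l) (D.tySub (K.p P) A) A (F.sect_lift_ty A P l) := by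
  apply F.hom_ext
  · rw [Category.assoc, devMap, F.liftOf_p, ← Category.assoc, F.liftOf_p, Category.assoc,
      F.sect_comp_liftOf φ hP l l' hl, Category.assoc, F.liftOf_p,
      ← Category.assoc (F.lift φ A), F.lift_p, Category.assoc]
  · refine (tmSub_comp_q _ _ ?_ (F.liftOf_q _ _ _ _)).trans ((F.liftOf_q _ _ _ _).trans
      ((tmSub_comp_q _ _ ?_ (F.liftOf_q _ _ _ _)).trans (F.liftOf_q _ _ _ rfl)).symm)
    · rw [F.liftOf_p, D.tySub_comp, ← F.devMap_ty]
    · rw [F.liftOf_p, D.tySub_comp, ← F.sect_lift_ty]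

variable {F}

/-- The dependent morphism from `Γ.A` to `B` given by a dependent morphism from `Γ` to a
dependent map space from `A` to `B`. -/
def PiSpace.uncurry {Γ : C} {A : D.Ty Γ} {B : D.Ty (K.ext Γ A)} (S : F.PiSpace A B)
    (l : D.Tm Γ S.ty) : D.Tm (K.ext Γ A) B :=
  D.cast (by rw [← D.tySub_comp, F.liftOf_sect_lift, D.tySub_id])
    (D.tmSub (F.liftOf (F.sect l) (D.tySub (K.p S.ty) A) A (F.sect_lift_ty A S.ty l)) S.dev)

theorem PiSpace.uncurry_curry {Γ : C} {A : D.Ty Γ} {B : D.Ty (K.ext Γ A)} (S : F.PiSpace A B)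
    (f : D.Tm (K.ext Γ A) B) : S.uncurry (S.pseudo.curry f) = f :=
  eq_of_heq ((D.cast_heq _ _).trans (S.pseudo.dev_curry f))

theorem PiSpace.curry_uncurry {Γ : C} {A : D.Ty Γ} {B : D.Ty (K.ext Γ A)} (S : F.PiSpace A B)
    (l : D.Tm Γ S.ty) : S.pseudo.curry (S.uncurry l) = l :=
  (S.pseudo.curry_unique _ _ (D.cast_heq _ _).symm).symm

variable {S : {Γ : C} → (A : D.Ty Γ) → (B : D.Ty (K.ext Γ A)) → F.PiSpace A B}

theorem PiCoherent.uncurry_sub (hS : F.PiCoherent S) {Δ Γ : C} (φ : Δ ⟶ Γ) {A : D.Ty Γ}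
    {B : D.Ty (K.ext Γ A)} (l : D.Tm Γ (S A B).ty) (l' : D.Tm Δ (S (D.tySub φ A)
      (D.tySub (F.lift φ A) B)).ty) (hl : HEq l' (D.tmSub φ l)) :
    (S (D.tySub φ A) (D.tySub (F.lift φ A) B)).uncurry l' =
      D.tmSub (F.lift φ A) ((S A B).uncurry l) := by
  have e : D.tySub (F.devMap φ A (S A B).ty _ (hS.ty_sub φ A B).symm)
        (D.tySub (F.lift (K.p (S A B).ty) A) B) =
      D.tySub (F.lift (K.p _) (D.tySub φ A)) (D.tySub (F.lift φ A) B) :=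
    (D.tySub_comp _ _ _).symm.trans ((congrArg (fun m => D.tySub m B)
      (F.devMap_lift φ A _ _ _)).trans (D.tySub_comp _ _ _))
  refine eq_of_heq ((D.cast_heq _ _).trans ?_)
  refine (D.tmSub_congr rfl e.symm (hS.dev_sub φ A B).symm).trans ?_
  refine (D.tmSub_comp _ _ _).symm.trans ?_
  refine (D.tmSub_congr (F.liftOf_sect_comp_devMap φ A _ _ (hS.ty_sub φ A B).symm l l' hl) rfl
    HEq.rfl).trans ?_
  refine (D.tmSub_comp _ _ _).trans (D.tmSub_congr rfl ?_ (D.cast_heq _ _).symm)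
  rw [← D.tySub_comp, F.liftOf_sect_lift, D.tySub_id]

/-- The inverse of a natural bijection is natural. -/
theorem PiCoherent.curry_sub (hS : F.PiCoherent S) {Δ Γ : C} (φ : Δ ⟶ Γ) {A : D.Ty Γ}
    {B : D.Ty (K.ext Γ A)} (f : D.Tm (K.ext Γ A) B) :
    HEq (D.tmSub φ ((S A B).pseudo.curry f))
      ((S (D.tySub φ A) (D.tySub (F.lift φ A) B)).pseudo.curry (D.tmSub (F.lift φ A) f)) := by
  rw [← PiSpace.uncurry_curry (S A B) f, ← hS.uncurry_sub φ _ _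
    (D.cast_heq (hS.ty_sub φ A B) _), PiSpace.curry_uncurry, PiSpace.curry_uncurry]
  exact (D.cast_heq _ _).symm

/-- The dependent function types given by a coherent family of dependent map spaces. -/
def PiCoherent.toPiTypes (hS : F.PiCoherent S) : F.PiTypes where
  pi A B := (S A B).ty
  lam {_ A B} f := (S A B).pseudo.curry f
  app {_ A B} h a := D.tmSub (F.sect a) ((S A B).uncurry h)
  app_lam f a := by rw [PiSpace.uncurry_curry]
  pi_sub := hS.ty_sub
  lam_sub φ _ _ g := hS.curry_sub φ g
  app_sub φ A B h a := by
    rw [hS.uncurry_sub φ h _ (D.cast_heq _ _)]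
    refine (D.tmSub_comp _ _ _).symm.trans (HEq.trans ?_ (D.tmSub_comp _ _ _))
    exact D.tmSub_congr (F.sect_comp_liftOf φ rfl a _ HEq.rfl).symm rfl HEq.rfl

theorem PiCoherent.toPiTypes_strict (hS : F.PiCoherent S) : hS.toPiTypes.Strict := by
  intro Γ A B h
  have : hS.toPiTypes.appVar (D.tmSub (K.p A) h) = (S A B).uncurry h := by
    refine eq_of_heq ((D.cast_heq _ _).trans ?_)
    change HEq (D.tmSub _ (PiSpace.uncurry _ _)) _
    refine (D.tmSub_congr rfl rfl
      (heq_of_eq (hS.uncurry_sub (K.p A) h _ (D.cast_heq _ _)))).trans ?_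
    -- Weakening and then applying to the variable cancel, since p⁺ ∘ ⟨id, v⟩ = id.
    exact (D.tmSub_comp _ _ _).symm.trans ((D.tmSub_congr (F.sect_q_lift A) rfl HEq.rfl).trans
      (D.tmSub_id _))
  rw [this]
  exact PiSpace.curry_uncurry _ h

end PiFamily

/-! ### Collapse under the projection equation -/

/-- If the two second projections on `Γ.A.A{p}` agree, then any two dependent morphisms with the
same codomain are equal. -/
theorem tm_subsingleton (F : CwF K) (h : ∀ {Γ : C} (A : D.Ty Γ),
      D.tmSub (K.p (D.tySub (K.p A) A)) (K.q A) = K.q (D.tySub (K.p A) A))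
    {Γ : C} {A : D.Ty Γ} (a b : D.Tm Γ A) : a = b := by
  -- The two morphisms Γ.A.A{p} → Γ.A select the first and the second copy of A; the hypothesis
  -- equates their generic terms.
  have e : K.p (D.tySub (K.p A) A) = F.lift (K.p A) A := by
    apply F.hom_ext
    · rw [F.lift_p]
    · exact (heq_of_eq (h A)).trans (F.liftOf_q _ _ _ rfl).symm
  have hb : A = D.tySub (F.sect a) (D.tySub (K.p A) A) := F.sect_lift_ty A A a
  -- Precomposing with ⟨⟨id, a⟩, b⟩ makes one side select `a` and the other select `b`.
  have e' := congrArg (F.pair (F.sect a) (D.tySub (K.p A) A) (D.cast hb b) ≫ ·) e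
  simp only [F.cons_l] at e'
  refine eq_of_heq ((F.sect_q a).symm.trans ?_)
  rw [e']
  refine (tmSub_comp_q _ _ ?_ (F.liftOf_q _ _ _ rfl)).trans
    ((F.cons_r _ _ _).trans (D.cast_heq _ _))
  rw [F.liftOf_p, D.tySub_comp]

variable {F}

/-! ### The pairing morphism of strict dependent pair types is invertible -/

section Sigma

variable (S : F.SigmaTypes) {Γ : C} (A : D.Ty Γ) (B : D.Ty (K.ext Γ A))

/-- The first projection from a dependent pair type. -/
def SigmaTypes.fst : D.Tm (K.ext Γ (S.sigma A B)) (D.tySub (K.p (S.sigma A B)) A) :=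
  S.elim _ (D.cast (by rw [← D.tySub_comp, ← D.tySub_comp, S.pair_p])
    (D.tmSub (K.p B) (K.q A)))

theorem SigmaTypes.pairHom_fst :
    S.pairHom A B ≫ F.pair (K.p (S.sigma A B)) A (S.fst A B) = K.p B := by
  apply F.hom_ext
  · rw [Category.assoc, F.cons_l, S.pair_p]
  · refine (tmSub_pair_comp _ (F.cons_l _ _ _) (F.cons_r _ _ _)).trans
      ((heq_of_eq (S.elim_pair _ _)).trans (D.cast_heq _ _))

/-- The second projection from a dependent pair type. -/
def SigmaTypes.snd :
    D.Tm (K.ext Γ (S.sigma A B)) (D.tySub (F.pair (K.p (S.sigma A B)) A (S.fst A B)) B) :=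
  S.elim _ (D.cast (by rw [← D.tySub_comp, S.pairHom_fst]) (K.q B))

/-- The morphism `⟨⟨p, fst⟩, snd⟩ : Γ.Σ(A, B) ⟶ Γ.A.B`. -/
def SigmaTypes.unpair : K.ext Γ (S.sigma A B) ⟶ K.ext (K.ext Γ A) B :=
  F.pair (F.pair (K.p (S.sigma A B)) A (S.fst A B)) B (S.snd A B)

theorem SigmaTypes.unpair_p_p :
    S.unpair A B ≫ K.p B ≫ K.p A = K.p (S.sigma A B) := by
  rw [← Category.assoc, unpair, F.cons_l, F.cons_l]

theorem SigmaTypes.pairHom_unpair : S.pairHom A B ≫ S.unpair A B = 𝟙 _ := by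
  apply F.hom_ext
  · rw [Category.assoc, unpair, F.cons_l, S.pairHom_fst, Category.id_comp]
  · refine (tmSub_pair_comp _ (F.cons_l _ _ _) (F.cons_r _ _ _)).trans
      ((heq_of_eq (S.elim_pair _ _)).trans ((D.cast_heq _ _).trans (D.tmSub_id _).symm))

/-- By strictness, terms over Γ.Σ(A,B) are determined by their reindexing along pairing. This is
applied to the generic term and its reindexing along the composite. -/
theorem SigmaTypes.Strict.unpair_pairHom {S : F.SigmaTypes} (hS : S.Strict) :
    S.unpair A B ≫ S.pairHom A B = 𝟙 _ := by
  have hp : (S.unpair A B ≫ S.pairHom A B) ≫ K.p _ = K.p (S.sigma A B) := by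
    rw [Category.assoc, S.pair_p, S.unpair_p_p]
  have hc : D.tySub (S.unpair A B ≫ S.pairHom A B) (D.tySub (K.p (S.sigma A B)) (S.sigma A B)) =
      D.tySub (K.p (S.sigma A B)) (S.sigma A B) := by
    rw [← D.tySub_comp, hp]
  apply F.hom_ext
  · rw [hp, Category.id_comp]
  · refine ((D.cast_heq hc _).symm.trans (heq_of_eq ?_)).trans (D.tmSub_id _).symm
    refine (hS _ _ _ rfl).trans (hS _ _ _ ?_).symm
    refine eq_of_heq (HEq.symm ?_)
    refine (D.tmSub_congr rfl hc.symm (D.cast_heq hc _)).trans ((D.tmSub_comp _ _ _).symm.trans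
      (D.tmSub_congr ?_ rfl HEq.rfl))
    rw [← Category.assoc, S.pairHom_unpair, Category.id_comp]

/-- Since pairing is invertible, the computation rule alone determines the eliminator, which can
then be handled by composing morphisms. -/
theorem SigmaTypes.Strict.elim_heq {S : F.SigmaTypes} (hS : S.Strict)
    {Γ : C} {A : D.Ty Γ} {B : D.Ty (K.ext Γ A)} (P : D.Ty (K.ext Γ (S.sigma A B)))
    (f : D.Tm (K.ext (K.ext Γ A) B) (D.tySub (S.pairHom A B) P)) :
    HEq (S.elim P f) (D.tmSub (S.unpair A B) f) := by
  refine HEq.trans ?_ ((D.tmSub_comp _ _ _).trans (D.tmSub_congr rfl rfl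
    (heq_of_eq (S.elim_pair P f))))
  exact ((D.tmSub_congr (hS.unpair_pairHom A B) rfl HEq.rfl).trans (D.tmSub_id _)).symm

theorem SigmaTypes.pairHom_liftOf {Δ : C} (φ : Δ ⟶ Γ) (A' : D.Ty Δ) (hA : A' = D.tySub φ A)
    (B' : D.Ty (K.ext Δ A')) (hB : B' = D.tySub (F.liftOf φ A A' hA) B)
    (h : S.sigma A' B' = D.tySub φ (S.sigma A B)) :
    S.pairHom A' B' ≫ F.liftOf φ (S.sigma A B) (S.sigma A' B') h =
      F.liftOf (F.liftOf φ A A' hA) B B' hB ≫ S.pairHom A B := by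
  subst hA hB
  exact S.pair_sub φ A B

end Sigma

/-- Leaving `A'` and `B'` free lets the denotation of a type over Δ replace the reindexing of its
denotation over Γ. -/
theorem PiTypes.lam_liftOf (P : F.PiTypes) {Δ Γ : C} (φ : Δ ⟶ Γ) {A : D.Ty Γ}
    {B : D.Ty (K.ext Γ A)} (g : D.Tm (K.ext Γ A) B) (A' : D.Ty Δ) (hA : A' = D.tySub φ A)
    (B' : D.Ty (K.ext Δ A')) (hB : D.tySub (F.liftOf φ A A' hA) B = B')
    (g' : D.Tm (K.ext Δ A') B') (hg : HEq (D.tmSub (F.liftOf φ A A' hA) g) g') :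
    HEq (D.tmSub φ (P.lam g)) (P.lam g') := by
  subst hA hB
  cases hg
  exact P.lam_sub φ g

/-! ### Semantic terms over strict type formers -/

/-- Unit types, dependent pair types and dependent function types in the strict sense. -/
structure StrictFormers (F : CwF K) where
  U : F.UnitType
  S : F.SigmaTypes
  P : F.PiTypes
  U_strict : U.Strict
  S_strict : S.Strict
  P_strict : P.Strict

namespace StrictFormers

variable (M : F.StrictFormers)

/-! ### Types

As types contain no terms, each type has a denotation over every object. -/

/-- The denotation of a type over an object. -/
def ty : PreTy → (X : C) → D.Ty X
  | .one, X => M.U.one X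
  | .pi A B, X => M.P.pi (ty A X) (ty B (K.ext X (ty A X)))
  | .sigma A B, X => M.S.sigma (ty A X) (ty B (K.ext X (ty A X)))

theorem ty_sub {X Y : C} (φ : X ⟶ Y) (A : PreTy) : D.tySub φ (M.ty A Y) = M.ty A X := by
  induction A generalizing X Y with
  | one => exact M.U.one_sub φ
  | pi A B ihA ihB => rw [ty, M.P.pi_sub, ihB, ihA, ty]
  | sigma A B ihA ihB => rw [ty, M.S.sigma_sub, ihB, ihA, ty]

/-- The semantic terms of a type over an object. -/
abbrev El (X : C) (A : PreTy) : Type w₂ := D.Tm X (M.ty A X)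

variable {M}

/-- Substitution in semantic terms. -/
def sub {X Y : C} (φ : X ⟶ Y) {A : PreTy} (a : M.El Y A) : M.El X A :=
  D.cast (M.ty_sub φ A) (D.tmSub φ a)

theorem sub_heq {X Y : C} (φ : X ⟶ Y) {A : PreTy} (a : M.El Y A) :
    HEq (sub φ a) (D.tmSub φ a) := D.cast_heq _ _

theorem sub_id {X : C} {A : PreTy} (a : M.El X A) : sub (𝟙 X) a = a :=
  eq_of_heq ((sub_heq _ _).trans (D.tmSub_id a))

theorem sub_comp {X Y Z : C} (ψ : X ⟶ Y) (φ : Y ⟶ Z) {A : PreTy} (a : M.El Z A) :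
    sub (ψ ≫ φ) a = sub ψ (sub φ a) :=
  eq_of_heq ((sub_heq _ _).trans ((D.tmSub_comp ψ φ a).trans
    ((D.tmSub_congr rfl (M.ty_sub φ A) (sub_heq φ a).symm).trans (sub_heq _ _).symm)))

/-! ### Comprehension -/

variable (M) in
/-- The extension of an object by a type. -/
abbrev ext (X : C) (A : PreTy) : C := K.ext X (M.ty A X)

variable (M) in
/-- The projection from an extension. -/
abbrev p (X : C) (A : PreTy) : M.ext X A ⟶ X := K.p (M.ty A X)

variable (M) in
/-- The generic term over an extension. -/
def v (X : C) (A : PreTy) : M.El (M.ext X A) A := D.cast (M.ty_sub _ A) (K.q (M.ty A X))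

theorem v_heq (X : C) (A : PreTy) : HEq (M.v X A) (K.q (M.ty A X)) := D.cast_heq _ _

theorem hom_ext {X Y : C} {A : PreTy} {m n : Y ⟶ M.ext X A} (hp : m ≫ M.p X A = n ≫ M.p X A)
    (hv : sub m (M.v X A) = sub n (M.v X A)) : m = n := by
  have key (k : Y ⟶ M.ext X A) : HEq (sub k (M.v X A)) (D.tmSub k (K.q (M.ty A X))) :=
    (sub_heq _ _).trans (D.tmSub_congr rfl (M.ty_sub _ A).symm (v_heq X A))
  exact F.hom_ext hp ((key m).symm.trans ((heq_of_eq hv).trans (key n)))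

/-- The extension of a morphism by a semantic term. -/
def cons {X Y : C} (φ : Y ⟶ X) {A : PreTy} (a : M.El Y A) : Y ⟶ M.ext X A :=
  F.pair φ (M.ty A X) (D.cast (M.ty_sub φ A).symm a)

theorem cons_p {X Y : C} (φ : Y ⟶ X) {A : PreTy} (a : M.El Y A) : cons φ a ≫ M.p X A = φ :=
  F.cons_l _ _ _

theorem sub_cons_v {X Y : C} (φ : Y ⟶ X) {A : PreTy} (a : M.El Y A) :
    sub (cons φ a) (M.v X A) = a :=
  eq_of_heq ((sub_heq _ _).trans ((D.tmSub_congr rfl (M.ty_sub _ A).symm (v_heq X A)).trans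
    ((F.cons_r _ _ _).trans (D.cast_heq _ _))))

theorem comp_cons {X Y Z : C} (ψ : Z ⟶ Y) (φ : Y ⟶ X) {A : PreTy} (a : M.El Y A) :
    ψ ≫ cons φ a = cons (ψ ≫ φ) (sub ψ a) := by
  apply hom_ext
  · rw [Category.assoc, cons_p, cons_p]
  · rw [sub_comp, sub_cons_v, sub_cons_v]

variable (M) in
/-- The extension of a morphism under a binder. -/
def up {X Y : C} (φ : X ⟶ Y) (A : PreTy) : M.ext X A ⟶ M.ext Y A :=
  F.liftOf φ (M.ty A Y) (M.ty A X) (M.ty_sub φ A).symm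

theorem up_p {X Y : C} (φ : X ⟶ Y) (A : PreTy) : M.up φ A ≫ M.p Y A = M.p X A ≫ φ :=
  F.liftOf_p _ _ _ _

theorem sub_up_v {X Y : C} (φ : X ⟶ Y) (A : PreTy) : sub (M.up φ A) (M.v Y A) = M.v X A :=
  eq_of_heq ((sub_heq _ _).trans ((D.tmSub_congr rfl (M.ty_sub _ A).symm (v_heq Y A)).trans
    ((F.liftOf_q _ _ _ _).trans (v_heq X A).symm)))

theorem cons_up {X Y Z : C} (φ : X ⟶ Y) (ψ : Y ⟶ Z) {A : PreTy} (a : M.El X A) :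
    cons φ a ≫ M.up ψ A = cons (φ ≫ ψ) a := by
  apply hom_ext
  · rw [Category.assoc, up_p, ← Category.assoc, cons_p, cons_p]
  · rw [sub_comp, sub_up_v, sub_cons_v, sub_cons_v]

/-- The section given by a semantic term. -/
def sec {X : C} {A : PreTy} (a : M.El X A) : X ⟶ M.ext X A := F.sect a

/-- The two transports differ only in the proof of the type equality. -/
theorem sec_eq {X : C} {A : PreTy} (a : M.El X A) : sec a = cons (𝟙 X) a := rfl

theorem comp_sec {X Y : C} (φ : X ⟶ Y) {A : PreTy} (a : M.El Y A) :
    φ ≫ sec a = sec (sub φ a) ≫ M.up φ A := by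
  rw [sec_eq, sec_eq, cons_up, comp_cons, Category.comp_id, Category.id_comp]

theorem sec_v_up {X : C} {A : PreTy} : sec (M.v X A) ≫ M.up (M.p X A) A = 𝟙 _ := by
  apply hom_ext
  · rw [sec_eq, cons_up, cons_p, Category.id_comp]
  · rw [sec_eq, cons_up, sub_cons_v, sub_id]

/-! ### Function types -/

/-- Abstraction. -/
def lam {X : C} {A B : PreTy} (f : M.El (M.ext X A) B) : M.El X (.pi A B) := M.P.lam f

/-- Application. -/
def app {X : C} {A B : PreTy} (h : M.El X (.pi A B)) (a : M.El X A) : M.El X B :=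
  D.cast (M.ty_sub (sec a) B) (M.P.app h a)

theorem app_lam {X : C} {A B : PreTy} (f : M.El (M.ext X A) B) (a : M.El X A) :
    app (lam f) a = sub (sec a) f := by
  rw [app, lam, M.P.app_lam]; rfl

/-- The η-rule makes abstraction surjective. Statements about application therefore reduce to β and
the naturality of abstraction. -/
theorem exists_lam {X : C} {A B : PreTy} (h : M.El X (.pi A B)) : ∃ f, h = lam f :=
  ⟨_, (M.P_strict h).symm⟩

theorem sub_lam {X Y : C} (φ : X ⟶ Y) {A B : PreTy} (f : M.El (M.ext Y A) B) :
    sub φ (lam f) = lam (sub (M.up φ A) f) :=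
  eq_of_heq ((sub_heq _ _).trans (M.P.lam_liftOf φ f _ _ _ (M.ty_sub _ B) _ (sub_heq _ _).symm))

theorem sub_app {X Y : C} (φ : X ⟶ Y) {A B : PreTy} (h : M.El Y (.pi A B)) (a : M.El Y A) :
    sub φ (app h a) = app (sub φ h) (sub φ a) := by
  obtain ⟨f, rfl⟩ := exists_lam h
  rw [sub_lam, app_lam, app_lam, ← sub_comp, ← sub_comp, comp_sec]

theorem lam_app {X : C} {A B : PreTy} (h : M.El X (.pi A B)) :
    lam (app (sub (M.p X A) h) (M.v X A)) = h := by
  obtain ⟨f, rfl⟩ := exists_lam h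
  rw [sub_lam, app_lam, ← sub_comp, sec_v_up, sub_id]

/-! ### Pair types -/

variable (M) in
/-- The pairing morphism. -/
def pr (X : C) (A B : PreTy) : M.ext (M.ext X A) B ⟶ M.ext X (.sigma A B) := M.S.pairHom _ _

variable (M) in
/-- The inverse of the pairing morphism. -/
def unpr (X : C) (A B : PreTy) : M.ext X (.sigma A B) ⟶ M.ext (M.ext X A) B := M.S.unpair _ _

theorem pr_p (X : C) (A B : PreTy) :
    M.pr X A B ≫ M.p X (.sigma A B) = M.p (M.ext X A) B ≫ M.p X A := M.S.pair_p _ _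

theorem pr_unpr (X : C) (A B : PreTy) : M.pr X A B ≫ M.unpr X A B = 𝟙 _ :=
  M.S.pairHom_unpair _ _

theorem unpr_pr (X : C) (A B : PreTy) : M.unpr X A B ≫ M.pr X A B = 𝟙 _ :=
  SigmaTypes.Strict.unpair_pairHom _ _ M.S_strict

theorem pr_up {X Y : C} (φ : X ⟶ Y) (A B : PreTy) :
    M.pr X A B ≫ M.up φ (.sigma A B) = M.up (M.up φ A) B ≫ M.pr Y A B :=
  M.S.pairHom_liftOf _ _ _ _ _ _ _ _

theorem up_unpr {X Y : C} (φ : X ⟶ Y) (A B : PreTy) :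
    M.up φ (.sigma A B) ≫ M.unpr Y A B = M.unpr X A B ≫ M.up (M.up φ A) B := by
  rw [← Category.id_comp (M.up φ (.sigma A B)), ← unpr_pr, Category.assoc, Category.assoc,
    ← Category.assoc (M.pr X A B), pr_up, Category.assoc, pr_unpr, Category.comp_id]

/-- Pairing of semantic terms. -/
def pair {X : C} {A B : PreTy} (a : M.El X A) (b : M.El X B) : M.El X (.sigma A B) :=
  sub (cons (sec a) b ≫ M.pr X A B) (M.v X (.sigma A B))

/-- Matches the dependent pairing, whose second component has a type reindexed along the section of
`a`, with the transported one. -/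
theorem mkTm_heq {X : C} {A B : PreTy} (a : M.El X A) (b : M.El X B)
    (b' : D.Tm X (D.tySub (F.sect a) (M.ty B (M.ext X A)))) (hb : HEq b' b) :
    HEq (M.S.mkTm (M.ty B (M.ext X A)) a b') (pair a b) := by
  have : b' = D.cast (M.ty_sub _ B).symm b := eq_of_heq (hb.trans (D.cast_heq _ _).symm)
  subst this
  exact (D.cast_heq _ _).trans ((D.tmSub_congr rfl (M.ty_sub (M.p X (.sigma A B)) _)
    (v_heq X (.sigma A B)).symm).trans (sub_heq _ _).symm)

theorem sec_pair {X : C} {A B : PreTy} (a : M.El X A) (b : M.El X B) :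
    sec (pair a b) = cons (sec a) b ≫ M.pr X A B := by
  apply hom_ext
  · rw [sec_eq, cons_p, Category.assoc, pr_p, ← Category.assoc, cons_p, sec_eq, cons_p]
  · rw [sec_eq, sub_cons_v, pair]

theorem sub_pair {X Y : C} (φ : X ⟶ Y) {A B : PreTy} (a : M.El Y A) (b : M.El Y B) :
    sub φ (pair a b) = pair (sub φ a) (sub φ b) := by
  rw [pair, pair, ← sub_comp, ← sub_up_v φ, ← sub_comp, Category.assoc, pr_up,
    ← Category.assoc _ (M.up (M.up φ A) B), cons_up, ← comp_sec, ← comp_cons, Category.assoc]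

/-- Elimination of pairs. -/
def elim {X : C} {A B T : PreTy} (g : M.El (M.ext (M.ext X A) B) T) (t : M.El X (.sigma A B)) :
    M.El X T := sub (sec t ≫ M.unpr X A B) g

theorem elim_heq {X : C} {A B T : PreTy} (g : M.El (M.ext (M.ext X A) B) T)
    (t : M.El X (.sigma A B))
    (g' : D.Tm (M.ext (M.ext X A) B) (D.tySub (M.S.pairHom (M.ty A X) (M.ty B (M.ext X A)))
      (M.ty T (M.ext X (.sigma A B))))) (hg : HEq g' g) :
    HEq (D.tmSub (F.sect t) (M.S.elim _ g')) (elim g t) := by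
  have e := M.ty_sub (M.pr X A B) T
  refine (D.tmSub_congr rfl ?_ (SigmaTypes.Strict.elim_heq M.S_strict _ g')).trans ((D.tmSub_comp _ _ _).symm.trans
    ((D.tmSub_congr rfl e hg).trans (sub_heq _ g).symm))
  exact ((D.tySub_comp _ _ _).symm.trans ((congrArg (fun m => D.tySub m _)
    (unpr_pr X A B)).trans (D.tySub_id _))).symm

theorem sub_elim {X Y : C} (φ : X ⟶ Y) {A B T : PreTy} (g : M.El (M.ext (M.ext Y A) B) T)
    (t : M.El Y (.sigma A B)) :
    sub φ (elim g t) = elim (sub (M.up (M.up φ A) B) g) (sub φ t) := by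
  rw [elim, elim, ← sub_comp, ← sub_comp, Category.assoc, ← up_unpr, ← Category.assoc φ, comp_sec,
    Category.assoc]

theorem elim_pair {X : C} {A B T : PreTy} (g : M.El (M.ext (M.ext X A) B) T) (a : M.El X A)
    (b : M.El X B) : elim g (pair a b) = sub (cons (sec a) b) g := by
  rw [elim, sec_pair, Category.assoc, pr_unpr, Category.comp_id]

theorem pair_elim {X : C} {A B : PreTy} (t : M.El X (.sigma A B)) :
    pair (elim (sub (M.p _ B) (M.v X A)) t) (elim (M.v (M.ext X A) B) t) = t := by
  -- The two projections of `t` are the components of `sec t ≫ M.unpr X A B`; pairing then cancels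
  -- `unpr`.
  have : cons (sec (elim (sub (M.p _ B) (M.v X A)) t)) (elim (M.v (M.ext X A) B) t) =
      sec t ≫ M.unpr X A B := by
    apply hom_ext
    · apply hom_ext
      · rw [cons_p, sec_eq, cons_p, Category.assoc, Category.assoc, ← pr_p,
          ← Category.assoc (M.unpr X A B), unpr_pr, Category.id_comp, sec_eq, cons_p]
      · rw [cons_p, sec_eq, sub_cons_v, sub_comp, elim]
    · rw [sub_cons_v, elim]
  rw [pair, this, Category.assoc, unpr_pr, Category.comp_id, sec_eq, sub_cons_v]

end StrictFormers

end CwF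

/-! ### Types contain no terms -/

theorem PreTy.ren_eq (A : PreTy) (ρ : ℕ → ℕ) : A.ren ρ = A := by
  induction A generalizing ρ <;> simp_all [PreTy.ren]

theorem PreTy.sub_eq (A : PreTy) (σ : ℕ → PreTm) : A.sub σ = A := by
  induction A generalizing σ <;> simp_all [PreTy.sub]

theorem Ctx.ren_eq (Δ : Ctx) (ρ : ℕ → ℕ) : Ctx.ren Δ ρ = Δ := by
  induction Δ <;> simp_all [Ctx.ren, PreTy.ren_eq]

theorem Ctx.sub_eq (Δ : Ctx) (σ : ℕ → PreTm) : Ctx.sub Δ σ = Δ := by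
  induction Δ <;> simp_all [Ctx.sub, PreTy.sub_eq]

/-! ### Denotations of contexts and terms, and soundness -/

namespace CwF.StrictFormers

variable {C : Type u} [Category.{v} C] {D : CwD.{w₂, w₁} C} {K : Comprehension D} {F : CwF K}
  (M : F.StrictFormers)

/-- The denotation of a context. -/
abbrev ctx : Ctx → C
  | [] => K.T
  | A :: Γ => M.ext (ctx Γ) A

/-- The denotations of terms, as a relation. -/
inductive Den : (Γ : Ctx) → PreTm → (A : PreTy) → M.El (M.ctx Γ) A → Prop
  | var_zero {Γ A} : Den (A :: Γ) (.var 0) A (M.v (M.ctx Γ) A)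
  | var_succ {Γ n A B u} : Den Γ (.var n) A u →
      Den (B :: Γ) (.var (n + 1)) A (sub (M.p (M.ctx Γ) B) u)
  | star {Γ} : Den Γ .star .one (M.U.star (M.ctx Γ))
  | lam {Γ A B b u} : Den (A :: Γ) b B u → Den Γ (.lam A b) (.pi A B) (StrictFormers.lam u)
  | app {Γ A B f a u w} : Den Γ f (.pi A B) u → Den Γ a A w →
      Den Γ (.app f a) B (StrictFormers.app u w)
  | pair {Γ A B a b u w} : Den Γ a A u → Den Γ b B w →
      Den Γ (.pair a b) (.sigma A B) (StrictFormers.pair u w)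
  | elim {Γ A B T g t u w} : Den (B :: A :: Γ) g T u → Den Γ t (.sigma A B) w →
      Den Γ (.elim A B T g t) T (StrictFormers.elim u w)

variable {M}

/-- The head of the term selects the clause, and the annotations on abstractions and eliminators fix
the contexts of the subterms. The type is not given in advance, so it is compared together with the
value. -/
theorem Den.unique {Γ a A A' u u'} (h : M.Den Γ a A u) (h' : M.Den Γ a A' u') :
    (⟨A, u⟩ : Σ A, M.El (M.ctx Γ) A) = ⟨A', u'⟩ := by
  induction h generalizing A' with
  | var_zero => cases h'; rfl
  | var_succ _ ih => cases h' with | var_succ h => cases ih h; rfl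
  | star => cases h'; rfl
  | lam _ ih => cases h' with | lam h => cases ih h; rfl
  | app _ _ ih₁ ih₂ => cases h' with | app h₁ h₂ => cases ih₁ h₁; cases ih₂ h₂; rfl
  | pair _ _ ih₁ ih₂ => cases h' with | pair h₁ h₂ => cases ih₁ h₁; cases ih₂ h₂; rfl
  | elim _ _ ih₁ ih₂ => cases h' with | elim h₁ h₂ => cases ih₁ h₁; cases ih₂ h₂; rfl

theorem Den.eq {Γ a A u u'} (h : M.Den Γ a A u) (h' : M.Den Γ a A u') : u = u' := by
  cases h.unique h'; rfl

theorem Den.exists_var {Γ : Ctx} {n A} (h : Γ[n]? = some A) : ∃ u, M.Den Γ (.var n) A u := by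
  induction Γ generalizing n with
  | nil => simp at h
  | cons B Γ ih =>
    cases n with
    | zero => obtain rfl : B = A := by simpa using h
              exact ⟨_, .var_zero⟩
    | succ n => obtain ⟨u, hu⟩ := ih (n := n) (by simpa using h)
                exact ⟨_, .var_succ hu⟩

/-! ### Renaming and substitution -/

variable (M) in
/-- The morphism `φ` interprets the renaming `ρ`. -/
def InterpRen (Δ Γ : Ctx) (ρ : ℕ → ℕ) (φ : M.ctx Δ ⟶ M.ctx Γ) : Prop :=
  ∀ n A u, M.Den Γ (.var n) A u → M.Den Δ (.var (ρ n)) A (sub φ u)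

variable (M) in
/-- The morphism `φ` interprets the substitution `σ`. -/
def InterpSub (Δ Γ : Ctx) (σ : ℕ → PreTm) (φ : M.ctx Δ ⟶ M.ctx Γ) : Prop :=
  ∀ n A u, M.Den Γ (.var n) A u → M.Den Δ (σ n) A (sub φ u)

theorem sub_up_sub_p {X Y : C} (φ : X ⟶ Y) {A B : PreTy} (u : M.El Y A) :
    sub (M.up φ B) (sub (M.p Y B) u) = sub (M.p X B) (sub φ u) := by
  rw [← sub_comp, up_p, sub_comp]

theorem InterpRen.up {Δ Γ ρ φ} (h : M.InterpRen Δ Γ ρ φ) (A : PreTy) :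
    M.InterpRen (A :: Δ) (A :: Γ) (upRen ρ) (M.up φ A) := by
  intro n B u hu
  cases hu with
  | var_zero => rw [sub_up_v]; exact .var_zero
  | var_succ hu => rw [sub_up_sub_p]; exact .var_succ (h _ _ _ hu)

theorem InterpRen.p (Γ : Ctx) (A : PreTy) :
    M.InterpRen (A :: Γ) Γ Nat.succ (M.p (M.ctx Γ) A) := fun _ _ _ hu => .var_succ hu

/-- For weakening below a context extension; validity needs only the existence of such a morphism.
-/
theorem InterpRen.exists_up {Δ Γ ρ φ} (h : M.InterpRen Δ Γ ρ φ) (Θ : Ctx) :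
    ∃ ψ, M.InterpRen (Θ ++ Δ) (Θ ++ Γ) (upRen^[Θ.length] ρ) ψ := by
  induction Θ with
  | nil => exact ⟨φ, h⟩
  | cons A Θ ih =>
    obtain ⟨ψ, hψ⟩ := ih
    refine ⟨M.up ψ A, ?_⟩
    rw [List.length_cons, Function.iterate_succ_apply']
    exact hψ.up A

theorem Den.ren {Δ Γ ρ φ a A u} (h : M.InterpRen Δ Γ ρ φ) (ha : M.Den Γ a A u) :
    M.Den Δ (a.ren ρ) A (StrictFormers.sub φ u) := by
  induction ha generalizing Δ ρ with
  | var_zero => exact h _ _ _ .var_zero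
  | var_succ hu => exact h _ _ _ (.var_succ hu)
  | star =>
    -- Uniqueness of terms of unit type identifies the transported reindexing of the star with the
    -- star.
    have e := M.U_strict (StrictFormers.sub (A := .one) φ (M.U.star _))
    rw [e]; exact .star
  | lam _ ih => rw [sub_lam, PreTm.ren, PreTy.ren_eq]; exact .lam (ih (h.up _))
  | app _ _ ih₁ ih₂ => rw [sub_app]; exact .app (ih₁ h) (ih₂ h)
  | pair _ _ ih₁ ih₂ => rw [sub_pair]; exact .pair (ih₁ h) (ih₂ h)
  | elim _ _ ih₁ ih₂ =>
    rw [sub_elim, PreTm.ren, PreTy.ren_eq, PreTy.ren_eq, PreTy.ren_eq]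
    exact .elim (ih₁ ((h.up _).up _)) (ih₂ h)

theorem InterpSub.up {Δ Γ σ φ} (h : M.InterpSub Δ Γ σ φ) (A : PreTy) :
    M.InterpSub (A :: Δ) (A :: Γ) (upSub σ) (M.up φ A) := by
  intro n B u hu
  cases hu with
  | var_zero => rw [sub_up_v]; exact .var_zero
  -- Lifting a substitution weakens arbitrary terms, so closure under renaming has to come first.
  | var_succ hu => rw [sub_up_sub_p]; exact (h _ _ _ hu).ren (InterpRen.p Δ A)

theorem InterpSub.exists_up {Δ Γ σ φ} (h : M.InterpSub Δ Γ σ φ) (Θ : Ctx) :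
    ∃ ψ, M.InterpSub (Θ ++ Δ) (Θ ++ Γ) (upSub^[Θ.length] σ) ψ := by
  induction Θ with
  | nil => exact ⟨φ, h⟩
  | cons A Θ ih =>
    obtain ⟨ψ, hψ⟩ := ih
    refine ⟨M.up ψ A, ?_⟩
    rw [List.length_cons, Function.iterate_succ_apply']
    exact hψ.up A

theorem InterpSub.sec {Γ a A u} (h : M.Den Γ a A u) :
    M.InterpSub Γ (A :: Γ) (inst a) (sec u) := by
  intro n B w hw
  cases hw with
  | var_zero => rw [sec_eq, sub_cons_v]; exact h
  | var_succ hw =>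
    rw [← sub_comp, sec_eq]; rw [cons_p, sub_id]; exact hw

theorem InterpSub.cons_sec {Γ a b A B u w} (ha : M.Den Γ a A u) (hb : M.Den Γ b B w) :
    M.InterpSub Γ (B :: A :: Γ) (inst₂ a b) (cons (StrictFormers.sec u) w) := by
  intro n T x hx
  cases hx with
  | var_zero => rw [sub_cons_v]; exact hb
  | @var_succ _ n _ _ x hx =>
    rw [← sub_comp]; rw [cons_p]
    have := InterpSub.sec ha _ _ _ hx
    -- Past the innermost variable, `inst₂ a b` agrees with `inst a` shifted by one.
    cases n <;> exact this

theorem Den.sub {Δ Γ σ φ a A u} (h : M.InterpSub Δ Γ σ φ) (ha : M.Den Γ a A u) :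
    M.Den Δ (a.sub σ) A (StrictFormers.sub φ u) := by
  induction ha generalizing Δ σ with
  | var_zero => exact h _ _ _ .var_zero
  | var_succ hu => exact h _ _ _ (.var_succ hu)
  | star =>
    have e := M.U_strict (StrictFormers.sub (A := .one) φ (M.U.star _))
    rw [e]; exact .star
  | lam _ ih => rw [sub_lam, PreTm.sub, PreTy.sub_eq]; exact .lam (ih (h.up _))
  | app _ _ ih₁ ih₂ => rw [sub_app]; exact .app (ih₁ h) (ih₂ h)
  | pair _ _ ih₁ ih₂ => rw [sub_pair]; exact .pair (ih₁ h) (ih₂ h)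
  | elim _ _ ih₁ ih₂ =>
    rw [sub_elim, PreTm.sub, PreTy.sub_eq, PreTy.sub_eq, PreTy.sub_eq]
    exact .elim (ih₁ ((h.up _).up _)) (ih₂ h)

/-! ### Soundness -/

variable (M) in
/-- Validity of judgements. -/
def Valid : Judgement → Prop
  | .on _ .ctx => True
  | .on _ (.ty _) => True
  | .on Γ (.tm a A) => ∃ u, M.Den Γ a A u
  | .on _ (.tyEq A B) => A = B
  | .on Γ (.tmEq a b A) => ∃ u, M.Den Γ a A u ∧ M.Den Γ b A u
  | .ctxEq Γ Δ => Γ = Δ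

/-- Each rule becomes a closure property of `Den`: conversion is trivial as equal types and contexts
are identical, the structural rules are renaming and substitution, and the β- and η-rules are
equations between semantic terms. -/
theorem valid_of_derivable {J : Judgement} (h : Derivable J) : M.Valid J := by
  induction h with
  | ctx_emp | ctx_ext | ty_con | one_form | pi_form | sigma_form => trivial
  | ctx_extEq _ _ ih₁ ih₂ => exact congrArg₂ _ ih₂ ih₁
  | var _ h => rw [PreTy.ren_eq]; exact Den.exists_var h
  | ctx_eqRefl | ty_eqRefl => rfl
  | ctx_eqSymm _ ih | ty_eqSymm _ ih => exact Eq.symm ih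
  | ctx_eqTrans _ _ ih₁ ih₂ | ty_eqTrans _ _ ih₁ ih₂ => exact Eq.trans ih₁ ih₂
  | tm_eqRefl _ ih => obtain ⟨u, h⟩ := ih; exact ⟨u, h, h⟩
  | tm_eqSymm _ ih => obtain ⟨u, h, h'⟩ := ih; exact ⟨u, h', h⟩
  | tm_eqTrans _ _ ih₁ ih₂ =>
    obtain ⟨u, h₁, h₂⟩ := ih₁
    obtain ⟨w, h₃, h₄⟩ := ih₂
    -- The middle term has a single denotation, which links the two equalities.
    cases h₂.eq h₃
    exact ⟨u, h₁, h₄⟩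
  | tm_con _ _ _ ih ih₁ ih₂ | tm_eqCon _ _ _ ih ih₁ ih₂ => cases ih₁; cases ih₂; exact ih
  | ty_eqCon _ _ _ ih => exact ih
  | @weak Γ Δ A J _ _ ih =>
    rw [Ctx.ren_eq]
    obtain ⟨ψ, hψ⟩ := (InterpRen.p (M := M) Γ A).exists_up Δ
    cases J with
    | ctx | ty => trivial
    | tm =>
      obtain ⟨u, h⟩ := ih
      rw [Rhs.ren, PreTy.ren_eq]
      exact ⟨_, h.ren hψ⟩
    | tyEq => exact congrArg (PreTy.ren · _) ih
    | tmEq =>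
      obtain ⟨u, h, h'⟩ := ih
      rw [Rhs.ren, PreTy.ren_eq]
      exact ⟨_, h.ren hψ, h'.ren hψ⟩
  | @subst Γ Δ A a J _ _ ih iha =>
    rw [Ctx.sub_eq]
    obtain ⟨w, hw⟩ := iha
    obtain ⟨ψ, hψ⟩ := (InterpSub.sec hw).exists_up Δ
    cases J with
    | ctx | ty => trivial
    | tm =>
      obtain ⟨u, h⟩ := ih
      rw [Rhs.sub, PreTy.sub_eq]
      exact ⟨_, h.sub hψ⟩
    | tyEq => exact congrArg (PreTy.sub · _) ih
    | tmEq =>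
      obtain ⟨u, h, h'⟩ := ih
      rw [Rhs.sub, PreTy.sub_eq]
      exact ⟨_, h.sub hψ, h'.sub hψ⟩
  | one_intro => exact ⟨_, .star⟩
  | one_uniq _ ih =>
    obtain ⟨u, h⟩ := ih
    refine ⟨u, h, ?_⟩
    rw [show u = M.U.star _ from M.U_strict u]
    exact .star
  | pi_formEq _ _ ih₁ ih₂ | sigma_formEq _ _ ih₁ ih₂ => exact congrArg₂ _ ih₁ ih₂
  | pi_intro _ ih => obtain ⟨u, h⟩ := ih; exact ⟨_, .lam h⟩
  | pi_introEq _ _ ih₁ ih₂ =>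
    cases ih₁
    obtain ⟨u, h, h'⟩ := ih₂
    exact ⟨_, .lam h, .lam h'⟩
  | pi_elim _ _ ih₁ ih₂ =>
    obtain ⟨u, h⟩ := ih₁
    obtain ⟨w, k⟩ := ih₂
    rw [PreTy.sub_eq]
    exact ⟨_, .app h k⟩
  | pi_elimEq _ _ ih₁ ih₂ =>
    obtain ⟨u, h, h'⟩ := ih₁
    obtain ⟨w, k, k'⟩ := ih₂
    rw [PreTy.sub_eq]
    exact ⟨_, .app h k, .app h' k'⟩
  | pi_comp _ _ ih₁ ih₂ =>
    obtain ⟨u, h⟩ := ih₁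
    obtain ⟨w, k⟩ := ih₂
    have e := h.sub (InterpSub.sec k)
    -- The substituted body denotes the reindexing along the section, which is the value of the
    -- β-redex.
    rw [← app_lam] at e
    rw [PreTy.sub_eq]
    exact ⟨_, .app (.lam h) k, e⟩
  | pi_uniq _ ih =>
    obtain ⟨u, h⟩ := ih
    have e := Den.lam (.app (h.ren (InterpRen.p _ _)) .var_zero)
    rw [lam_app] at e
    exact ⟨u, e, h⟩
  | sigma_intro _ _ _ _ ih₁ ih₂ =>
    obtain ⟨u, h⟩ := ih₁
    rw [PreTy.sub_eq] at ih₂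
    obtain ⟨w, k⟩ := ih₂
    exact ⟨_, .pair h k⟩
  | sigma_introEq _ _ _ _ ih₁ ih₂ =>
    obtain ⟨u, h, h'⟩ := ih₁
    rw [PreTy.sub_eq] at ih₂
    obtain ⟨w, k, k'⟩ := ih₂
    exact ⟨_, .pair h k, .pair h' k'⟩
  | sigma_elim _ _ _ _ ih₁ ih₂ =>
    rw [PreTy.sub_eq] at ih₁ ⊢
    obtain ⟨u, h⟩ := ih₁
    obtain ⟨w, k⟩ := ih₂
    exact ⟨_, .elim h k⟩
  | sigma_elimEq _ _ _ _ _ ihA ihB ihT ih₁ ih₂ =>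
    rw [PreTy.sub_eq] at ih₁ ⊢
    cases ihA; cases ihB; cases ihT
    obtain ⟨u, h, h'⟩ := ih₁
    obtain ⟨w, k, k'⟩ := ih₂
    exact ⟨_, .elim h k, .elim h' k'⟩
  | sigma_comp _ _ _ _ _ ihg iha ihb =>
    rw [PreTy.sub_eq] at ihg ihb ⊢
    obtain ⟨u, h⟩ := ihg
    obtain ⟨w, k⟩ := iha
    obtain ⟨w', k'⟩ := ihb
    have e := h.sub (InterpSub.cons_sec k k')
    rw [← elim_pair] at e
    exact ⟨_, .elim h (.pair k k'), e⟩
  | @sigma_uniq Γ A B t _ ih =>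
    obtain ⟨u, h⟩ := ih
    have e := Den.pair (.elim (.var_succ .var_zero) h) (.elim (.var_zero (A := B)) h)
    rw [pair_elim] at e
    refine ⟨u, ?_, h⟩
    -- The motives of the two projections collapse to `A` and `B`, as renaming and substitution fix
    -- types.
    rwa [PreTm.fst, PreTm.snd, PreTy.wk, PreTy.ren_eq, PreTy.sub_eq]

/-! ### Comparison with the interpretation -/

/-- The context is a mere label here: the denotation depends only on the object, so the conversion
clause has no effect. -/
theorem tyInterp_iff {Γ X A α} : TyInterp M.U M.S M.P Γ X A α ↔ α = M.ty A X := by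
  constructor
  · intro h
    induction h with
    | con _ _ ih => exact ih
    | one => rfl
    | pi _ _ ih₁ ih₂ | sigma _ _ ih₁ ih₂ => subst ih₁ ih₂; rfl
  · rintro rfl
    induction A generalizing Γ X with
    | one => exact .one
    | pi A B ihA ihB => exact .pi ihA ihB
    | sigma A B ihA ihB => exact .sigma ihA ihB

theorem ctxInterp_iff {Γ X} : CtxInterp M.U M.S M.P Γ X ↔ X = M.ctx Γ := by
  constructor
  · intro h
    induction h with
    | emp => rfl
    | ext _ h ih => subst ih; cases tyInterp_iff.1 h; rfl
  · rintro rfl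
    induction Γ with
    | nil => exact .emp
    | cons A Γ ih => exact .ext ih (tyInterp_iff.2 rfl)

/-- The clauses produce reindexed types that equal `ty A X` only propositionally, hence the
heterogeneous equality. The equation for `X` stays a hypothesis so that the indices remain free in
the induction. -/
theorem den_of_tmInterp {Γ X a A α u} (h : TmInterp M.U M.S M.P Γ X a A α u)
    (hX : X = M.ctx Γ)  : α = M.ty A X ∧ ∃ u', HEq u u' ∧ M.Den Γ a A u' := by
  induction h with
  | con h₁ h₂ _ ih =>
    -- Validity turns both derivable equalities into identities, so the conversion clause adds no
    -- denotation.
    cases (valid_of_derivable h₁ : M.Valid _)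
    cases (valid_of_derivable h₂ : M.Valid _)
    exact ih hX
  | var_zero hΓ hA =>
    cases ctxInterp_iff.1 hΓ
    cases tyInterp_iff.1 hA
    rw [PreTy.wk, PreTy.ren_eq]
    exact ⟨M.ty_sub _ _, _, (v_heq _ _).symm, .var_zero⟩
  | var_succ hΓ _ hB ih =>
    cases ctxInterp_iff.1 hΓ
    cases tyInterp_iff.1 hB
    obtain ⟨rfl, u, ⟨⟩, h⟩ := ih rfl
    rw [PreTy.wk, PreTy.ren_eq]
    exact ⟨M.ty_sub _ _, _, (sub_heq _ _).symm, .var_succ h⟩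
  | star => cases hX; exact ⟨rfl, _, HEq.rfl, .star⟩
  | lam hA _ ih =>
    cases hX
    cases tyInterp_iff.1 hA
    obtain ⟨rfl, u, ⟨⟩, h⟩ := ih rfl
    exact ⟨rfl, _, HEq.rfl, .lam h⟩
  | app hA hB _ _ ih₁ ih₂ =>
    cases hX
    cases tyInterp_iff.1 hA
    cases tyInterp_iff.1 hB
    obtain ⟨_, u, ⟨⟩, h⟩ := ih₁ rfl
    obtain ⟨_, w, ⟨⟩, k⟩ := ih₂ rfl
    rw [PreTy.sub_eq]
    exact ⟨M.ty_sub _ _, _, (D.cast_heq _ _).symm, .app h k⟩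
  | @pair _ _ A _ _ _ _ _ _ _ hB _ _ ih₁ ih₂ =>
    cases hX
    obtain ⟨rfl, u, ⟨⟩, h⟩ := ih₁ rfl
    cases tyInterp_iff.1 hB
    rw [PreTy.sub_eq] at ih₂
    obtain ⟨_, w, e, k⟩ := ih₂ rfl
    exact ⟨rfl, _, mkTm_heq (A := A) _ w _ e, .pair h k⟩
  | elim hA hB hT _ _ ih₁ ih₂ =>
    cases hX
    cases tyInterp_iff.1 hA
    cases tyInterp_iff.1 hB
    cases tyInterp_iff.1 hT
    rw [PreTy.sub_eq] at ih₁ ⊢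
    obtain ⟨_, u, e, h⟩ := ih₁ rfl
    obtain ⟨_, w, ⟨⟩, k⟩ := ih₂ rfl
    exact ⟨M.ty_sub _ _, _, elim_heq u _ _ e, .elim h k⟩

theorem Den.tmInterp {Γ a A u} (h : M.Den Γ a A u) :
    TmInterp M.U M.S M.P Γ (M.ctx Γ) a A (M.ty A (M.ctx Γ)) u := by
  -- Moves an interpretation along the syntactic type, its denotation and the value at once, since
  -- the three can only change together.
  have cast : ∀ {Γ X a A A' α α' u u'}, TmInterp M.U M.S M.P Γ X a A α u → A = A' → α = α' →
      HEq u u' → TmInterp M.U M.S M.P Γ X a A' α' u' := by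
    rintro _ _ _ _ _ _ _ _ _ h rfl rfl ⟨⟩; exact h
  induction h with
  | var_zero =>
    exact cast (.var_zero (ctxInterp_iff.2 rfl) (tyInterp_iff.2 rfl)) (PreTy.ren_eq _ _)
      (M.ty_sub _ _) (v_heq _ _).symm
  | var_succ _ ih =>
    exact cast (.var_succ (ctxInterp_iff.2 rfl) ih (tyInterp_iff.2 rfl)) (PreTy.ren_eq _ _)
      (M.ty_sub _ _) (sub_heq _ _).symm
  | star => exact .star
  | lam _ ih => exact .lam (tyInterp_iff.2 rfl) ih
  | app _ _ ih₁ ih₂ =>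
    exact cast (.app (tyInterp_iff.2 rfl) (tyInterp_iff.2 rfl) ih₁ ih₂) (PreTy.sub_eq _ _)
      (M.ty_sub _ _) (D.cast_heq _ _).symm
  | pair _ _ ih₁ ih₂ =>
    exact cast (.pair (tyInterp_iff.2 rfl) ih₁ (cast ih₂ (PreTy.sub_eq _ _).symm
      (M.ty_sub _ _).symm (D.cast_heq (M.ty_sub _ _).symm _).symm)) rfl rfl
      (mkTm_heq _ _ _ (D.cast_heq _ _))
  | elim _ _ ih₁ ih₂ =>
    exact cast (.elim (tyInterp_iff.2 rfl) (tyInterp_iff.2 rfl) (tyInterp_iff.2 rfl)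
      (cast ih₁ (PreTy.sub_eq _ _).symm (M.ty_sub (M.pr _ _ _) _).symm
        (D.cast_heq (M.ty_sub (M.pr _ _ _) _).symm _).symm) ih₂)
      (PreTy.sub_eq _ _) (M.ty_sub _ _) (elim_heq _ _ _ (D.cast_heq _ _))

theorem ctxDen_iff {Γ X} : CtxDen M.U M.S M.P Γ X ↔ X = M.ctx Γ := ctxInterp_iff

theorem tyDen_iff {Γ A s} : TyDen M.U M.S M.P Γ A s ↔ s = ⟨M.ctx Γ, M.ty A _⟩ := by
  obtain ⟨X, α⟩ := s
  constructor
  · rintro ⟨h₁, h₂⟩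
    cases ctxInterp_iff.1 h₁
    obtain rfl : α = _ := tyInterp_iff.1 h₂
    rfl
  · rintro ⟨⟩
    exact ⟨ctxInterp_iff.2 rfl, tyInterp_iff.2 rfl⟩

theorem tmDen_iff {Γ a A u} (h : M.Den Γ a A u) (s) :
    TmDen M.U M.S M.P Γ a A s ↔ s = ⟨M.ctx Γ, M.ty A _, u⟩ := by
  obtain ⟨X, α, w⟩ := s
  constructor
  · rintro ⟨h₁, h₂, h₃⟩
    cases ctxInterp_iff.1 h₁
    obtain rfl : α = _ := tyInterp_iff.1 h₂
    obtain ⟨_, w', ⟨⟩, h'⟩ := den_of_tmInterp h₃ rfl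
    cases h.eq h'
    rfl
  · rintro ⟨⟩
    exact ⟨ctxInterp_iff.2 rfl, tyInterp_iff.2 rfl, h.tmInterp⟩

variable (M) in
/-- The interpretation in a category with families that supports unit types, dependent pair types
and dependent function types in the strict sense is sound. -/
theorem sound : Sound M.U M.S M.P where
  ctx _ := ⟨_, ctxDen_iff.2 rfl, fun _ => ctxDen_iff.1⟩
  ty _ := ⟨_, tyDen_iff.2 rfl, fun _ => tyDen_iff.1⟩
  tm h := by
    obtain ⟨u, h⟩ := (valid_of_derivable h : M.Valid _)
    exact ⟨_, (tmDen_iff h _).2 rfl, fun _ => (tmDen_iff h _).1⟩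
  ctxEq h := by
    cases (valid_of_derivable h : M.Valid _)
    exact ⟨_, fun _ => ctxDen_iff, fun _ => ctxDen_iff⟩
  tyEq h := by
    cases (valid_of_derivable h : M.Valid _)
    exact ⟨_, fun _ => tyDen_iff, fun _ => tyDen_iff⟩
  tmEq h := by
    obtain ⟨u, h, h'⟩ := (valid_of_derivable h : M.Valid _)
    exact ⟨_, tmDen_iff h, tmDen_iff h'⟩

end CwF.StrictFormers
end DepCat

/-! ### The category with families of a strict CCCwD -/

theorem mainTheorem1 {C : Type*} [Category C] (S : StrictCCCwD C) :
    ∃ (U : S.cwf.UnitType) (Sg : S.cwf.SigmaTypes) (P : S.cwf.PiTypes),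
      U.Strict ∧ Sg.Strict ∧ P.Strict ∧
      -- the type formers are those given by the structure of `S`
      (∀ Γ : C, U.one Γ = S.D.tySub (S.K.isTerminal.from Γ) S.unit.one) ∧
      (∀ {Γ : C} (A : S.D.Ty Γ) (B : S.D.Ty (S.K.ext Γ A)),
        Sg.sigma A B = (S.sigma A B).ty ∧
        HEq (Sg.pairHom A B) (CwF.SigmaSpace.pairHom (S.sigma A B))) ∧
      (∀ {Γ : C} (A : S.D.Ty Γ) (B : S.D.Ty (S.K.ext Γ A)),
        P.pi A B = (S.pi A B).ty ∧
        ∀ f : S.D.Tm (S.K.ext Γ A) B, HEq (P.lam f) ((S.pi A B).pseudo.curry f)) ∧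
      -- with the projection equation, uniqueness holds for all `k`
      (S.ProjEq → P.OpenUniq) ∧
      -- the interpretation of MLTT(1, Π, Σ) is sound
      Sound U Sg P := by
  let M : S.cwf.StrictFormers :=
    { U := S.unit.toUnitType S.cwf
      S := S.sigma_coherent.toSigmaTypes
      P := S.pi_coherent.toPiTypes
      U_strict := S.unit.toUnitType_strict S.cwf
      S_strict := S.sigma_coherent.toSigmaTypes_strict
      P_strict := S.pi_coherent.toPiTypes_strict }
  exact ⟨M.U, M.S, M.P, M.U_strict, M.S_strict, M.P_strict, fun _ => rfl,
    fun _ _ => ⟨rfl, HEq.rfl⟩, fun _ _ => ⟨rfl, fun _ => HEq.rfl⟩,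
    -- Under the projection equation, open uniqueness is an equation between two parallel
    -- D-morphisms, all of which coincide.
    fun h _ _ _ _ => S.cwf.tm_subsingleton h _ _, M.sound⟩
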